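/- Let $\mathcal S,\mathcal A$ be finite sets, $H$ a horizon and $s_{\mathrm{init}}\in\mathcal S$ a fixed initial state. Let $\mathbf M$ be the set of tabular episodic MDPs $M=(p,\mu)$ with transition probabilities $p_h(\cdot\mid s,a)$ on $\mathcal S$ and Gaussian rewards $R_h(s,a)=\mathcal N(\mu_h(s,a),1)$, $\mu_h(s,a)\in(0,1)$, for $s\in\mathcal S$, $a\in\mathcal A$, $h\in\{1,\dots,H\}$. Let $\Pi$ be the set of all Markovian (possibly stochastic) policies $\pi=(\pi_h(\cdot\mid s))_{h,s}$. For $\pi\in\Pi$ let $\mathbb P_M^\pi$ be the law of an episode $(s_h,a_h,r_h,s_{h+1})_{h\le H}$ with $s_1=s_{\mathrm{init}}$, $a_h\sim\pi_h(\cdot\mid s_h)$, $r_h\sim R_h(s_h,a_h)$, $s_{h+1}\sim p_h(\cdot\mid s_h,a_h)$; let $V_0^\pi(M)=\mathbb E_M^\pi[\sum_{h=1}^H r_h]$ and $\Pi^\star(M)=\arg\max_{\pi\in\Pi}V_0^\pi(M)$. An algorithm chooses, before each episode $t\ge 1$, an exploration policy in $\Pi$ as a measurable function of the trajectories of the previous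 episodes and of external randomness whose law does not depend on the MDP; it observes the trajectory of an episode played with that policy; it has a stopping time $\tau\in\mathbb N\cup\{\infty\}$ (the number of episodes) with respect to the filtration of this information, and recommends after $t$ episodes a policy $\hat\pi_t\in\Pi$ that is measurable with respect to the information at time $t$. For $\delta\in(0,1)$ it is $\delta$-PAC if $\mathbb P_M(\tau<\infty,\ \hat\pi_\tau\notin\Pi^\star(M))\le\delta$ for every $M\in\mathbf M$. For $M\in\mathbf M$ let - $\Omega_M=\{(w_h^\pi(s,a))_{h,s,a}:\pi\in\Pi\}$ with $w_h^\pi(s,a)=\mathbb P_M^\pi(s_h=s,a_h=a)$; - $\mathrm{Alt}(M)$ be the set of $M'=(p',\mu')\in\mathbf M$, with rewards $R'_h(s,a)$, such that $\Pi^\star(M)\cap\Pi^\star(M')=\emptyset$ and $M\ll M'$, that is, $p_h(\cdot\mid s,a)\ll p'_h(\cdot\mid s,a)$ and $R_h(s,a)\ll R'_h(s,a)$ for all $(s,a,h)$; - $\mathrm{KL}(M\Vert M')_{s,a,h}=\mathrm{KL}\bigl(R_h(s,a)\otimes p_h(\cdot\mid s,a)\,\Vert\,R'_h(s,a)\otimes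 p'_h(\cdot\mid s,a)\bigr)$; - $\Gamma_M=\sup_{w\in\Omega_M}\ \inf_{M'\in\mathrm{Alt}(M)}\ \sum_{s,a,h}w_h(s,a)\,\mathrm{KL}(M\Vert M')_{s,a,h}\in[0,\infty]$, where $\inf\emptyset=\infty$. **Theorem.** Let $\delta\in(0,1)$. Then for every $\delta$-PAC algorithm with stopping time $\tau$ and every $M\in\mathbf M$ (in particular for every $M$ with a unique optimal policy), $$\mathbb E_M[\tau]\ \ge\ \Gamma_M^{-1}\,\log\frac{1}{2.4\,\delta},$$ where $0^{-1}=\infty$ and $\infty^{-1}=0$, and where the inequality is understood to be trivially true if $\log\frac{1}{2.4\delta}\le 0$. -/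

import Mathlib

open MeasureTheory ProbabilityTheory Finset
open scoped ENNReal

universe u

noncomputable section

/-! ### Tabular episodic Markov decision processes

Stages are indexed by `Fin H`, so that stage `1, …, H` of the mathematical text is
`0, …, H - 1` here. The state space `S` and the action space `A` are finite sets. -/

/-- The probability measure on a finite set `I` with the given vector of point masses. -/
def simplexKernel (I : Type u) [Fintype I] [MeasurableSpace I] :
    Kernel (stdSimplex ℝ I) I where
  toFun q := ∑ i, ENNReal.ofReal ((q : I → ℝ) i) • Measure.dirac i
  measurable' := by
    refine Measure.measurable_of_measurable_coe _ fun s _ => ?_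
    simp only [Measure.coe_finsetSum, Finset.sum_apply, Measure.smul_apply, smul_eq_mul]
    refine Finset.measurable_sum _ fun i _ => Measurable.mul_const ?_ _
    exact ENNReal.measurable_ofReal.comp ((measurable_pi_apply i).comp measurable_subtype_coe)

instance (I : Type u) [Fintype I] [MeasurableSpace I] : IsMarkovKernel (simplexKernel I) where
  isProbabilityMeasure q := ⟨by
    change (∑ i, ENNReal.ofReal ((q : I → ℝ) i) • Measure.dirac i : Measure I) Set.univ = 1
    simp only [Measure.coe_finsetSum, Finset.sum_apply, Measure.smul_apply, smul_eq_mul,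
      measure_univ, mul_one]
    exact (ENNReal.ofReal_sum_of_nonneg fun i _ => q.2.1 i).symm.trans
      ((congrArg ENNReal.ofReal q.2.2).trans ENNReal.ofReal_one)⟩

/-- The parameters of a tabular MDP with horizon `H`: mean rewards in `(0, 1)` and transition
probabilities. The reward of `(s, a)` at stage `h` is Gaussian with mean `mean h s a` and
variance `1`. -/
structure MDP (S A : Type u) [Fintype S] (H : ℕ) where
  mean : Fin H → S → A → ℝ
  mean_mem : ∀ h s a, mean h s a ∈ Set.Ioo (0 : ℝ) 1
  trans : Fin H → S → A → stdSimplex ℝ S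

/-- Markovian, possibly stochastic policies: `π h s` is a distribution over actions. -/
abbrev Policy (S A : Type u) [Fintype A] (H : ℕ) : Type u := Fin H → S → stdSimplex ℝ A

/-- An observation `(s_h, a_h, r_h, s_{h+1})`. -/
abbrev Step (S A : Type u) : Type u := S × A × ℝ × S

/-- The trajectory `(s_h, a_h, r_h, s_{h+1})_h` of one episode. -/
abbrev Episode (S A : Type u) (H : ℕ) : Type u := Fin H → Step S A

namespace MDP

theorem measurable_cons {S A : Type u} [MeasurableSpace S] [MeasurableSpace A] (H : ℕ) : Measurable fun z : Step S A × Episode S A H =>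
    (Fin.cons (α := fun _ => Step S A) z.1 z.2 : Episode S A (H + 1)) := by
  refine measurable_pi_lambda _ fun h => ?_
  refine Fin.cases ?_ (fun i => ?_) h
  · simpa using measurable_fst
  · simp only [Fin.cons_succ]
    exact (measurable_pi_apply i).comp measurable_snd

variable {S A : Type u} [Fintype S] [Fintype A] [MeasurableSpace S] [MeasurableSpace A]
  [DiscreteMeasurableSpace S] [DiscreteMeasurableSpace A] {H : ℕ}

/-- The Gaussian reward distribution `R_h(s, a)`. -/
def rewardLaw (M : MDP S A H) (h : Fin H) (s : S) (a : A) : Measure ℝ :=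
  gaussianReal (M.mean h s a) 1

/-- The next-state distribution `p_h(· | s, a)`. -/
def transLaw (M : MDP S A H) (h : Fin H) (s : S) (a : A) : Measure S :=
  simplexKernel S (M.trans h s a)

/-- The distribution `R_h(s, a) ⊗ p_h(· | s, a)` of reward and next state. -/
def outcomeLaw (M : MDP S A H) (h : Fin H) (s : S) (a : A) : Measure (ℝ × S) :=
  (M.rewardLaw h s a).prod (M.transLaw h s a)

instance (M : MDP S A H) (h : Fin H) (s : S) (a : A) :
    IsProbabilityMeasure (M.rewardLaw h s a) := by
  unfold rewardLaw; infer_instance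

instance (M : MDP S A H) (h : Fin H) (s : S) (a : A) :
    IsProbabilityMeasure (M.transLaw h s a) := by
  unfold transLaw; infer_instance

instance (M : MDP S A H) (h : Fin H) (s : S) (a : A) :
    IsProbabilityMeasure (M.outcomeLaw h s a) := by
  unfold outcomeLaw; infer_instance

/-- The law of the action played in state `s` at stage `h` under policy `π`, as a kernel
in `(π, s)`. -/
def actionKernel (h : Fin H) : Kernel (Policy S A H × S) A :=
  (simplexKernel A).comap (fun z => z.1 h z.2) <| by
    refine measurable_from_prod_countable_left fun s => ?_
    exact (measurable_pi_apply s).comp (measurable_pi_apply h)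

instance (h : Fin H) : IsMarkovKernel (actionKernel h : Kernel (Policy S A H × S) A) := by
  unfold actionKernel; infer_instance

/-- The law of reward and next state, as a kernel in `(s, a)`. -/
def outcomeKernel (M : MDP S A H) (h : Fin H) : Kernel (S × A) (ℝ × S) :=
  Kernel.ofFunOfCountable fun z => M.outcomeLaw h z.1 z.2

instance (M : MDP S A H) (h : Fin H) : IsMarkovKernel (M.outcomeKernel h) where
  isProbabilityMeasure z :=
    inferInstanceAs (IsProbabilityMeasure (M.outcomeLaw h z.1 z.2))

/-- The law of `(s_h, a_h, r_h, s_{h+1})` given `s_h = s` under policy `π`, as a kernel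
in `(π, s)`: the action is drawn from `π h s`, then reward and next state from the model. -/
def stepKernel (M : MDP S A H) (h : Fin H) : Kernel (Policy S A H × S) (Step S A) :=
  Kernel.deterministic (fun z : Policy S A H × S => z.2) measurable_snd ×ₖ
    (actionKernel h ⊗ₖ (M.outcomeKernel h).comap
      (fun z : (Policy S A H × S) × A => (z.1.2, z.2)) (by fun_prop))

instance (M : MDP S A H) (h : Fin H) : IsMarkovKernel (M.stepKernel h) := by
  unfold stepKernel; infer_instance

/-- The model of the stages after the first one. -/
def tail (M : MDP S A (H + 1)) : MDP S A H where
  mean h := M.mean h.succ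
  mean_mem h := M.mean_mem h.succ
  trans h := M.trans h.succ

/-- The law of the trajectory of an episode that starts in state `s` and follows policy `π`,
as a kernel in `(π, s)`: a first step, then an episode of the remaining stages from the state
just reached. -/
def episodeKernel : {H : ℕ} → MDP S A H → Kernel (Policy S A H × S) (Episode S A H)
  | 0, _ => Kernel.const _ (Measure.dirac Fin.elim0)
  | _ + 1, M =>
    (M.stepKernel 0 ⊗ₖ (episodeKernel M.tail).comap
        (fun z => ((fun h => z.1.1 h.succ), z.2.2.2.2)) (by fun_prop)).map
      (fun z => Fin.cons (α := fun _ => Step S A) z.1 z.2)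

instance instIsMarkovKernelEpisode : {H : ℕ} → (M : MDP S A H) → IsMarkovKernel M.episodeKernel
  | 0, _ => by unfold episodeKernel; infer_instance
  | _ + 1, M => by
    have := instIsMarkovKernelEpisode M.tail
    unfold episodeKernel
    exact Kernel.IsMarkovKernel.map _ (measurable_cons _)

/-- The law `P_M^π` of the trajectory of an episode started in `sInit`. -/
def episodeLaw (M : MDP S A H) (sInit : S) (π : Policy S A H) : Measure (Episode S A H) :=
  M.episodeKernel (π, sInit)

/-- The value `V_0^π`: the expected sum of the rewards of an episode started in `sInit`. -/
def value (M : MDP S A H) (sInit : S) (π : Policy S A H) : ℝ :=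
  ∫ ω, ∑ h, (ω h).2.2.1 ∂(M.episodeLaw sInit π)

/-- The set `Π⋆(M)` of optimal policies: the maximizers of `V_0^π` over all policies. -/
def optimalPolicies (M : MDP S A H) (sInit : S) : Set (Policy S A H) :=
  {π | ∀ π', M.value sInit π' ≤ M.value sInit π}

/-- The visitation probabilities `w_h^π(s, a) = P_M^π(s_h = s, a_h = a)`. -/
def visitation (M : MDP S A H) (sInit : S) (π : Policy S A H) : Fin H → S → A → ℝ≥0∞ :=
  fun h s a => M.episodeLaw sInit π {ω | (ω h).1 = s ∧ (ω h).2.1 = a}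

/-- The set `Ω_M` of visitation vectors induced by Markovian policies. -/
def visitationSet (M : MDP S A H) (sInit : S) : Set (Fin H → S → A → ℝ≥0∞) :=
  Set.range (M.visitation sInit)

/-- `M ≪ M'`: all transition and reward distributions are absolutely continuous. -/
def AbsCont (M M' : MDP S A H) : Prop :=
  ∀ h s a, M.transLaw h s a ≪ M'.transLaw h s a ∧ M.rewardLaw h s a ≪ M'.rewardLaw h s a

/-- The set `Alt(M)` of alternative models: `M ≪ M'` and no policy is optimal in both. -/
def alt (M : MDP S A H) (sInit : S) : Set (MDP S A H) :=
  {M' | M.AbsCont M' ∧ M.optimalPolicies sInit ∩ M'.optimalPolicies sInit = ∅}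

/-- `KL(M ‖ M')_{s,a,h}`: the divergence between the laws of reward and next state. -/
def kl (M M' : MDP S A H) (h : Fin H) (s : S) (a : A) : ℝ≥0∞ :=
  InformationTheory.klDiv (M.outcomeLaw h s a) (M'.outcomeLaw h s a)

/-- `Γ_M`, as an element of `[0, ∞]`; it is `∞` if there is no alternative model. -/
def Gam (M : MDP S A H) (sInit : S) : ℝ≥0∞ :=
  ⨆ w ∈ M.visitationSet sInit, ⨅ M' ∈ M.alt sInit, ∑ h, ∑ s, ∑ a, w h s a * M.kl M' h s a

end MDP

/-! ### Adaptive algorithms and their interaction with a model -/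

/-- What is revealed at time `t`: the random seed of the algorithm at time `0`, and the
trajectory of the `t`-th episode at time `t ≥ 1`. -/
def Obs (U S A : Type u) (H : ℕ) : ℕ → Type u
  | 0 => U
  | _ + 1 => Episode S A H

instance (U S A : Type u) (H : ℕ) [MeasurableSpace U] [MeasurableSpace S] [MeasurableSpace A] :
    (t : ℕ) → MeasurableSpace (Obs U S A H t)
  | 0 => inferInstanceAs (MeasurableSpace U)
  | _ + 1 => inferInstanceAs (MeasurableSpace (Episode S A H))

/-- The seed and the trajectories of the first `t` episodes. -/
abbrev History (U S A : Type u) (H t : ℕ) : Type u := (i : Finset.Iic t) → Obs U S A H i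

/-- A best-policy-identification algorithm. Its external randomness is a seed in `U`, drawn
before the first episode from a law that does not depend on the model (the seed may be a whole
sequence `(U_1, U_2, …)` of random variables). The policy explored in episode `t + 1` and the
policy recommended after episode `t` are measurable functions of the seed and of the first `t`
episodes; the number `τ` of episodes is a stopping time of the filtration that they generate. -/
structure Algorithm (U S A : Type u) [Fintype A] [MeasurableSpace U] [MeasurableSpace S]
    [MeasurableSpace A] (H : ℕ) where
  seedLaw : Measure U
  seedLaw_prob : IsProbabilityMeasure seedLaw
  explore : (t : ℕ) → History U S A H t → Policy S A H
  measurable_explore : ∀ t, Measurable (explore t)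
  τ : ((t : ℕ) → Obs U S A H t) → WithTop ℕ
  isStoppingTime_τ : IsStoppingTime (Filtration.piLE (X := Obs U S A H)) τ
  recommend : (t : ℕ) → History U S A H t → Policy S A H
  measurable_recommend : ∀ t, Measurable (recommend t)

namespace Algorithm

variable {U S A : Type u} [Fintype S] [Fintype A] [MeasurableSpace U] [MeasurableSpace S]
  [MeasurableSpace A] [DiscreteMeasurableSpace S] [DiscreteMeasurableSpace A] {H : ℕ}

/-- The conditional law of the trajectory of episode `t + 1` given the history: an episode of
`M` from `sInit` under the policy chosen by the algorithm. -/
def nextEpisode (alg : Algorithm U S A H) (M : MDP S A H) (sInit : S) (t : ℕ) :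
    Kernel (History U S A H t) (Obs U S A H (t + 1)) :=
  M.episodeKernel.comap (fun x => (alg.explore t x, sInit))
    ((alg.measurable_explore t).prodMk measurable_const)

instance (alg : Algorithm U S A H) (M : MDP S A H) (sInit : S) (t : ℕ) :
    IsMarkovKernel (alg.nextEpisode M sInit t) :=
  inferInstanceAs (IsMarkovKernel (M.episodeKernel.comap (fun x => (alg.explore t x, sInit))
    ((alg.measurable_explore t).prodMk measurable_const)))

/-- The law `P_M` of the whole interaction of the algorithm with the model `M`. -/
def law (alg : Algorithm U S A H) (M : MDP S A H) (sInit : S) :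
    Measure ((t : ℕ) → Obs U S A H t) :=
  Kernel.trajMeasure (X := Obs U S A H) alg.seedLaw (alg.nextEpisode M sInit)

/-- The algorithm is `δ`-PAC: in every model, the probability that it stops and recommends a
policy that is not optimal is at most `δ`. -/
def IsPAC (alg : Algorithm U S A H) (sInit : S) (δ : ℝ) : Prop :=
  ∀ M : MDP S A H,
    alg.law M sInit {ω | ∃ t : ℕ, alg.τ ω = t ∧
      alg.recommend t (fun i => ω i) ∉ M.optimalPolicies sInit} ≤ ENNReal.ofReal δ

/-- The expected number `E_M[τ]` of episodes, in `[0, ∞]`. -/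
def expectedTime (alg : Algorithm U S A H) (M : MDP S A H) (sInit : S) : ℝ≥0∞ :=
  ∫⁻ ω, ENat.toENNReal (alg.τ ω) ∂(alg.law M sInit)

end Algorithm

end

set_option linter.unusedSectionVars false

noncomputable section

/-! ### Log-likelihood ratios -/

/-! The proof is a change of measure at the stopping time. Fix `M` with finite expected time, an
alternative `M'`, and the event that the algorithm stops and recommends a policy optimal in `M`. By
the PAC property this event has probability at least `1 - δ` under `M`. Under `M'` it has
probability at most `δ`, because no policy is optimal in both models. Hence the expected
log-likelihood ratio of the data up to `τ` is at least the binary relative entropy `(1 - 2δ) log((1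
- δ)/δ)`, which exceeds `log(1/(2.4δ))` (`AdaptiveProcess.binary_relative_entropy_le_tsum`,
`log_inv_le_binary_relative_entropy`).

Policy probabilities cancel in the likelihood ratio, so each episode contributes the divergences
`kl` weighted by the visitation probabilities of the policy explored (`MDP.integral_episodeLLR`).
Summed over the episodes before `τ`, these probabilities equal the expected time multiplied by the
visitation vector of one Markovian policy `ρ` (`Algorithm.exists_policy_tsum_visitation`); this is
the convexity of the visitation set. As `ρ` does not depend on `M'`, the infimum over alternatives
can be taken afterwards, and it is at most `Γ_M`.

Only the inequality `E_M[g exp(-L)] ≤ E_M'[g]` is needed of the likelihood ratio `L`, so mass of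
`M'` outside the support of `M` is harmless. -/

theorem llr_withDensity_exp {α : Type*} [MeasurableSpace α] {μ ν : Measure α} [SigmaFinite ν]
    {f : α → ℝ} (hf : Measurable f)
    (h : μ = ν.withDensity fun x => ENNReal.ofReal (Real.exp (f x))) : llr μ ν =ᵐ[ν] f := by
  have hm : Measurable fun x => ENNReal.ofReal (Real.exp (f x)) := by fun_prop
  have := Measure.rnDeriv_withDensity ν hm
  rw [← h] at this
  filter_upwards [this] with x hx
  rw [llr, hx, ENNReal.toReal_ofReal (Real.exp_pos _).le, Real.log_exp]

/-- The product of the two densities is a density of the product. Its logarithm splits where both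
factors are positive and finite, which holds almost everywhere for the first law. -/
theorem llr_prod_ae {α β : Type*} [MeasurableSpace α] [MeasurableSpace β]
    {μ ν : Measure α} {μ' ν' : Measure β} [IsProbabilityMeasure μ] [IsProbabilityMeasure ν]
    [IsProbabilityMeasure μ'] [IsProbabilityMeasure ν'] (h : μ ≪ ν) (h' : μ' ≪ ν') :
    llr (μ.prod μ') (ν.prod ν') =ᵐ[μ.prod μ'] fun z => llr μ ν z.1 + llr μ' ν' z.2 := by
  have hprod : μ.prod μ' = (ν.prod ν').withDensity fun z => μ.rnDeriv ν z.1 * μ'.rnDeriv ν' z.2 := by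
    rw [← prod_withDensity (Measure.measurable_rnDeriv _ _) (Measure.measurable_rnDeriv _ _),
      Measure.withDensity_rnDeriv_eq _ _ h, Measure.withDensity_rnDeriv_eq _ _ h']
  have hm : Measurable fun z : α × β => μ.rnDeriv ν z.1 * μ'.rnDeriv ν' z.2 :=
    ((Measure.measurable_rnDeriv _ _).comp measurable_fst).mul
      ((Measure.measurable_rnDeriv _ _).comp measurable_snd)
  have h1 := Measure.rnDeriv_withDensity (ν.prod ν') hm
  rw [← hprod] at h1
  have hac : μ.prod μ' ≪ ν.prod ν' := h.prod h'
  have p1 := (Measure.quasiMeasurePreserving_fst (μ := μ) (ν := μ')).ae (Measure.rnDeriv_pos h)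
  have p2 := (Measure.quasiMeasurePreserving_snd (μ := μ) (ν := μ')).ae (Measure.rnDeriv_pos h')
  have p3 := (Measure.quasiMeasurePreserving_fst (μ := μ) (ν := μ')).ae
    (h.ae_le (Measure.rnDeriv_lt_top μ ν))
  have p4 := (Measure.quasiMeasurePreserving_snd (μ := μ) (ν := μ')).ae
    (h'.ae_le (Measure.rnDeriv_lt_top μ' ν'))
  filter_upwards [hac.ae_le h1, p1, p2, p3, p4] with z hz h1 h2 h3 h4
  rw [llr, hz, ENNReal.toReal_mul, Real.log_mul]
  · rfl
  · exact (ENNReal.toReal_pos h1.ne' h3.ne).ne'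
  · exact (ENNReal.toReal_pos h2.ne' h4.ne).ne'

/-- With equal variances the quadratic terms cancel, so the log-ratio is affine in `x`. -/
theorem integrable_llr_gaussianReal (m m' : ℝ) :
    Integrable (llr (gaussianReal m 1) (gaussianReal m' 1)) (gaussianReal m 1) := by
  have hac : gaussianReal m 1 ≪ gaussianReal m' 1 :=
    (gaussianReal_absolutelyContinuous m one_ne_zero).trans
      (gaussianReal_absolutelyContinuous' m' one_ne_zero)
  have hq : Measurable fun x : ℝ => (m - m') * x - (m ^ 2 - m' ^ 2) / 2 := by fun_prop
  have hd : gaussianReal m 1 = (gaussianReal m' 1).withDensity fun x =>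
      ENNReal.ofReal (Real.exp ((m - m') * x - (m ^ 2 - m' ^ 2) / 2)) := by
    rw [gaussianReal_of_var_ne_zero _ one_ne_zero, gaussianReal_of_var_ne_zero _ one_ne_zero,
      ← withDensity_mul _ (measurable_gaussianPDF _ _) (by fun_prop)]
    congr 1
    ext x
    rw [Pi.mul_apply, gaussianPDF, gaussianPDF,
      ← ENNReal.ofReal_mul (gaussianPDFReal_nonneg _ _ _), gaussianPDFReal, gaussianPDFReal,
      mul_assoc (√_)⁻¹, ← Real.exp_add]
    congr 3
    simp only [NNReal.coe_one]
    ring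
  have hint : Integrable (fun x : ℝ => (m - m') * x - (m ^ 2 - m' ^ 2) / 2) (gaussianReal m 1) :=
    (((memLp_id_gaussianReal (μ := m) (v := 1) 1).integrable (by simp)).const_mul _).sub
      (integrable_const _)
  exact hint.congr (Filter.EventuallyEq.symm (hac.ae_le (llr_withDensity_exp hq hd)))

/-- `exp (-llr μ ν)` is the density with respect to `μ` of the absolutely continuous part of `ν`;
the singular part of `ν` accounts for the inequality. -/
theorem lintegral_mul_exp_neg_llr_le {α : Type*} [MeasurableSpace α] {μ ν : Measure α}
    [IsProbabilityMeasure μ] [IsProbabilityMeasure ν] (h : μ ≪ ν) {g : α → ℝ≥0∞}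
    (hg : Measurable g) :
    ∫⁻ x, g x * ENNReal.ofReal (Real.exp (-llr μ ν x)) ∂μ ≤ ∫⁻ x, g x ∂ν := by
  calc ∫⁻ x, g x * ENNReal.ofReal (Real.exp (-llr μ ν x)) ∂μ
      = ∫⁻ x, (ν.rnDeriv μ * g) x ∂μ := by
        refine lintegral_congr_ae ?_
        filter_upwards [exp_neg_llr h, Measure.rnDeriv_lt_top ν μ] with x hx hx'
        rw [hx, ENNReal.ofReal_toReal hx'.ne, Pi.mul_apply, mul_comm]
    _ = ∫⁻ x, g x ∂(μ.withDensity (ν.rnDeriv μ)) :=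
        (lintegral_withDensity_eq_lintegral_mul _ (Measure.measurable_rnDeriv _ _) hg).symm
    _ ≤ ∫⁻ x, g x ∂ν := lintegral_mono' (Measure.withDensity_rnDeriv_le _ _) le_rfl

theorem lintegral_simplexKernel {I : Type u} [Fintype I] [MeasurableSpace I]
    [DiscreteMeasurableSpace I] (q : stdSimplex ℝ I) (f : I → ℝ≥0∞) :
    ∫⁻ i, f i ∂(simplexKernel I q) = ∑ i, ENNReal.ofReal ((q : I → ℝ) i) * f i := by
  change ∫⁻ i, f i ∂(∑ i, ENNReal.ofReal ((q : I → ℝ) i) • Measure.dirac i : Measure I) = _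
  rw [lintegral_finsetSum_measure]
  refine Finset.sum_congr rfl fun i _ => ?_
  rw [lintegral_smul_measure, lintegral_dirac' _ (measurable_of_countable f), smul_eq_mul]

theorem sum_comm_pairs {ι κ ι' κ' R : Type*} [Fintype ι] [Fintype κ] [Fintype ι'] [Fintype κ']
    [AddCommMonoid R] (F : ι → κ → ι' → κ' → R) :
    ∑ b, ∑ c, ∑ x, ∑ y, F b c x y = ∑ x, ∑ y, ∑ b, ∑ c, F b c x y := by
  calc ∑ b, ∑ c, ∑ x, ∑ y, F b c x y = ∑ b, ∑ x, ∑ y, ∑ c, F b c x y :=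
        Finset.sum_congr rfl fun b _ => Finset.sum_comm.trans
          (Finset.sum_congr rfl fun x _ => Finset.sum_comm)
    _ = _ := Finset.sum_comm.trans (Finset.sum_congr rfl fun x _ => Finset.sum_comm)

namespace MDP

variable {S A : Type u} [Fintype S] [Fintype A] [MeasurableSpace S] [MeasurableSpace A]
  [DiscreteMeasurableSpace S] [DiscreteMeasurableSpace A] {H : ℕ}

theorem AbsCont.outcomeLaw {M M' : MDP S A H} (h : M.AbsCont M') (i : Fin H) (s : S) (a : A) :
    M.outcomeLaw i s a ≪ M'.outcomeLaw i s a :=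
  (h i s a).2.prod (h i s a).1

/-- The log-ratio is a Gaussian part plus a function on the finite set `S`. Absolute continuity
alone therefore makes every divergence finite. -/
theorem integrable_llr_outcomeLaw {M M' : MDP S A H} (h : M.AbsCont M') (i : Fin H) (s : S)
    (a : A) :
    Integrable (llr (M.outcomeLaw i s a) (M'.outcomeLaw i s a)) (M.outcomeLaw i s a) := by
  have h1 : Integrable (llr (M.rewardLaw i s a) (M'.rewardLaw i s a)) (M.rewardLaw i s a) :=
    integrable_llr_gaussianReal _ _
  have h2 : Integrable (llr (M.transLaw i s a) (M'.transLaw i s a)) (M.transLaw i s a) :=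
    Integrable.of_finite
  exact ((h1.comp_fst _).add (h2.comp_snd _)).congr
    (llr_prod_ae (h i s a).2 (h i s a).1).symm

theorem kl_ne_top {M M' : MDP S A H} (h : M.AbsCont M') (i : Fin H) (s : S) (a : A) :
    M.kl M' i s a ≠ ⊤ :=
  InformationTheory.klDiv_ne_top (h.outcomeLaw i s a) (integrable_llr_outcomeLaw h i s a)

theorem integral_llr_outcomeLaw {M M' : MDP S A H} (h : M.AbsCont M') (i : Fin H) (s : S)
    (a : A) :
    ∫ z, llr (M.outcomeLaw i s a) (M'.outcomeLaw i s a) z ∂(M.outcomeLaw i s a) =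
      (M.kl M' i s a).toReal :=
  (InformationTheory.toReal_klDiv_of_measure_eq (h.outcomeLaw i s a) (by simp)).symm

/-! ### The law of one episode -/

theorem lintegral_stepKernel (M : MDP S A H) (h : Fin H) (π : Policy S A H) (s : S)
    {f : Step S A → ℝ≥0∞} (hf : Measurable f) :
    ∫⁻ z, f z ∂(M.stepKernel h (π, s)) =
      ∑ a, ENNReal.ofReal ((π h s : A → ℝ) a) * ∫⁻ z, f (s, a, z) ∂(M.outcomeLaw h s a) := by
  unfold stepKernel
  rw [Kernel.prod_apply, lintegral_prod _ hf.aemeasurable, Kernel.deterministic_apply,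
    lintegral_dirac' _ (by fun_prop)]
  rw [Kernel.lintegral_compProd _ _ _ (by fun_prop)]
  exact lintegral_simplexKernel _ _

/-- The restriction of a policy to the stages after the first one. -/
def tailPolicy (π : Policy S A (H + 1)) : Policy S A H := fun h => π h.succ

theorem measurable_tailPolicy : Measurable (tailPolicy : Policy S A (H + 1) → Policy S A H) :=
  measurable_pi_lambda _ fun h => measurable_pi_apply h.succ

/-- First-step analysis, the basis of the inductions on the horizon. -/
theorem lintegral_episodeKernel_succ (M : MDP S A (H + 1)) (π : Policy S A (H + 1)) (s : S)
    {f : Episode S A (H + 1) → ℝ≥0∞} (hf : Measurable f) :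
    ∫⁻ ω, f ω ∂(M.episodeKernel (π, s)) =
      ∑ a, ENNReal.ofReal ((π 0 s : A → ℝ) a) * ∫⁻ z, ∫⁻ ω,
        f (Fin.cons (α := fun _ => Step S A) (s, a, z) ω)
          ∂(M.tail.episodeKernel (tailPolicy π, z.2)) ∂(M.outcomeLaw 0 s a) := by
  have hc := measurable_cons (S := S) (A := A) H
  rw [episodeKernel, Kernel.map_apply _ hc, lintegral_map hf hc,
    Kernel.lintegral_compProd _ _ _ (f := fun z : Step S A × Episode S A H =>
      f (Fin.cons (α := fun _ => Step S A) z.1 z.2)) (hf.comp hc), lintegral_stepKernel]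
  · rfl
  · have h1 : Measurable fun p : (((Policy S A (H + 1) × S) × Step S A) × Episode S A H) =>
        f (Fin.cons (α := fun _ => Step S A) p.1.2 p.2) :=
      hf.comp (hc.comp ((measurable_snd.comp measurable_fst).prodMk measurable_snd))
    exact (Measurable.lintegral_kernel_prod_right' h1).comp
      (measurable_const.prodMk measurable_id)

theorem lintegral_episodeKernel_zero_step (M : MDP S A (H + 1)) (π : Policy S A (H + 1)) (s : S)
    {f : Step S A → ℝ≥0∞} (hf : Measurable f) :
    ∫⁻ ω, f (ω 0) ∂(M.episodeKernel (π, s)) =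
      ∑ a, ENNReal.ofReal ((π 0 s : A → ℝ) a) * ∫⁻ z, f (s, a, z) ∂(M.outcomeLaw 0 s a) := by
  rw [lintegral_episodeKernel_succ _ _ _ (f := fun ω => f (ω 0)) (by fun_prop)]
  simp

theorem lintegral_episodeKernel_succ_step (M : MDP S A (H + 1)) (π : Policy S A (H + 1)) (s : S)
    (h : Fin H) {f : Step S A → ℝ≥0∞} (hf : Measurable f) :
    ∫⁻ ω, f (ω h.succ) ∂(M.episodeKernel (π, s)) =
      ∑ a, ENNReal.ofReal ((π 0 s : A → ℝ) a) *
        ∑ s', ENNReal.ofReal ((M.trans 0 s a : S → ℝ) s') *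
          ∫⁻ ω, f (ω h) ∂(M.tail.episodeKernel (tailPolicy π, s')) := by
  rw [lintegral_episodeKernel_succ _ _ _ (f := fun ω => f (ω h.succ)) (by fun_prop)]
  refine Finset.sum_congr rfl fun a _ => ?_
  simp only [Fin.cons_succ]
  rw [outcomeLaw, lintegral_prod _ ?_]
  · simp only [lintegral_const, measure_univ, mul_one]
    rw [transLaw, lintegral_simplexKernel]
  · exact ((measurable_of_countable fun s' : S =>
      ∫⁻ ω, f (ω h) ∂(M.tail.episodeKernel (tailPolicy π, s'))).comp measurable_snd).aemeasurable

theorem measurableSet_stateAction (s : S) (a : A) :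
    MeasurableSet {x : Step S A | x.1 = s ∧ x.2.1 = a} :=
  (measurable_fst (measurableSet_singleton s)).inter
    ((measurable_fst.comp measurable_snd) (measurableSet_singleton a))

theorem visitation_eq_lintegral (M : MDP S A H) (s₀ : S) (π : Policy S A H) (h : Fin H) (s : S)
    (a : A) :
    M.visitation s₀ π h s a =
      ∫⁻ ω, Set.indicator {x : Step S A | x.1 = s ∧ x.2.1 = a} 1 (ω h)
        ∂(M.episodeKernel (π, s₀)) := by
  have := lintegral_indicator_one (μ := M.episodeKernel (π, s₀))
    ((measurable_pi_apply h) (measurableSet_stateAction s a))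
  exact this.symm

theorem visitation_zero [DecidableEq S] (M : MDP S A (H + 1)) (s₀ : S) (π : Policy S A (H + 1))
    (s : S) (a : A) :
    M.visitation s₀ π 0 s a = if s = s₀ then ENNReal.ofReal ((π 0 s₀ : A → ℝ) a) else 0 := by
  classical
  rw [visitation_eq_lintegral, lintegral_episodeKernel_zero_step _ _ _
    (measurable_one.indicator (measurableSet_stateAction s a)), Finset.sum_eq_single a]
  · by_cases hs : s = s₀ <;> simp [Set.indicator, hs, eq_comm]
  · intro b _ hb
    simp [Set.indicator, hb]
  · simp

theorem visitation_succ (M : MDP S A (H + 1)) (s₀ : S) (π : Policy S A (H + 1)) (h : Fin H)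
    (s : S) (a : A) :
    M.visitation s₀ π h.succ s a = ∑ b, ENNReal.ofReal ((π 0 s₀ : A → ℝ) b) *
      ∑ s', ENNReal.ofReal ((M.trans 0 s₀ b : S → ℝ) s') *
        M.tail.visitation s' (tailPolicy π) h s a := by
  simp only [visitation_eq_lintegral]
  exact lintegral_episodeKernel_succ_step _ _ _ _
    (measurable_one.indicator (measurableSet_stateAction s a))

/-- In the `h`-th step of an episode, the state-action pair is visited with probability
`visitation`, and the outcome is drawn from the model. -/
theorem lintegral_episodeKernel_step : ∀ {H : ℕ} (M : MDP S A H) (s₀ : S) (π : Policy S A H)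
    (h : Fin H) {f : Step S A → ℝ≥0∞} (_ : Measurable f),
    ∫⁻ ω, f (ω h) ∂(M.episodeKernel (π, s₀)) =
      ∑ s, ∑ a, M.visitation s₀ π h s a * ∫⁻ z, f (s, a, z) ∂(M.outcomeLaw h s a)
  | 0, _, _, _, h, _, _ => h.elim0
  | H + 1, M, s₀, π, h, f, hf => by
    classical
    refine Fin.cases ?_ (fun i => ?_) h
    · rw [lintegral_episodeKernel_zero_step _ _ _ hf, Finset.sum_eq_single s₀]
      · simp [visitation_zero]
      · intro s _ hs
        simp [visitation_zero, hs]
      · simp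
    · rw [lintegral_episodeKernel_succ_step _ _ _ _ hf]
      simp_rw [visitation_succ, lintegral_episodeKernel_step M.tail _ _ i hf, Finset.mul_sum,
        Finset.sum_mul, sum_comm_pairs (ι := A)]
      refine Finset.sum_congr rfl fun s _ => Finset.sum_congr rfl fun a _ =>
        Finset.sum_congr rfl fun b _ => Finset.sum_congr rfl fun s' _ => ?_
      rw [mul_assoc, mul_assoc]
      rfl

/-- The identity of measures behind `lintegral_episodeKernel_step`, in the form required for Bochner
integrals of signed log-ratios. -/
theorem map_episodeKernel_step (M : MDP S A H) (s₀ : S) (π : Policy S A H) (h : Fin H) :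
    (M.episodeKernel (π, s₀)).map (fun ω => ω h) = ∑ s, ∑ a, M.visitation s₀ π h s a •
      (M.outcomeLaw h s a).map (fun z => (s, a, z)) := by
  refine Measure.ext_of_lintegral _ fun f hf => ?_
  rw [lintegral_map hf (measurable_pi_apply h), lintegral_episodeKernel_step M s₀ π h hf]
  simp only [lintegral_finsetSum_measure, lintegral_smul_measure, smul_eq_mul]
  refine Finset.sum_congr rfl fun s _ => Finset.sum_congr rfl fun a _ => ?_
  rw [lintegral_map hf (by fun_prop)]

/-- The sum of the log-likelihood ratios of the outcomes observed in an episode. -/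
def episodeLLR (M M' : MDP S A H) (ω : Episode S A H) : ℝ :=
  ∑ h, llr (M.outcomeLaw h (ω h).1 (ω h).2.1) (M'.outcomeLaw h (ω h).1 (ω h).2.1) (ω h).2.2

theorem measurable_stepLLR (M M' : MDP S A H) (h : Fin H) :
    Measurable fun x : Step S A =>
      llr (M.outcomeLaw h x.1 x.2.1) (M'.outcomeLaw h x.1 x.2.1) x.2.2 := by
  refine measurable_from_prod_countable_right fun s => ?_
  refine measurable_from_prod_countable_right fun a => ?_
  exact measurable_llr (M.outcomeLaw h s a) (M'.outcomeLaw h s a)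

theorem measurable_episodeLLR (M M' : MDP S A H) : Measurable (M.episodeLLR M') :=
  Finset.measurable_sum _ fun h _ => (measurable_stepLLR M M' h).comp (measurable_pi_apply h)

/-- Both models are run with the same policy, so the action weights agree and only the outcome laws
have to be exchanged. -/
theorem lintegral_mul_exp_neg_episodeLLR_le : ∀ {H : ℕ} {M M' : MDP S A H} (_ : M.AbsCont M')
    (π : Policy S A H) (s : S) {g : Episode S A H → ℝ≥0∞} (_ : Measurable g),
    ∫⁻ ω, g ω * ENNReal.ofReal (Real.exp (-M.episodeLLR M' ω)) ∂(M.episodeKernel (π, s)) ≤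
      ∫⁻ ω, g ω ∂(M'.episodeKernel (π, s))
  | 0, M, M', _, π, s, g, _ => by
    simp only [episodeLLR, Finset.univ_eq_empty, Finset.sum_empty, neg_zero, Real.exp_zero,
      ENNReal.ofReal_one, mul_one]
    exact le_of_eq rfl
  | H + 1, M, M', hM, π, s, g, hg => by
    have htail : M.tail.AbsCont M'.tail := fun i => hM i.succ
    have hl := measurable_episodeLLR M M'
    have hc := measurable_cons (S := S) (A := A) H
    rw [lintegral_episodeKernel_succ _ _ _ (by fun_prop),
      lintegral_episodeKernel_succ _ _ _ hg]
    refine Finset.sum_le_sum fun a _ => mul_le_mul' le_rfl ?_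
    have hm : Measurable fun p : (ℝ × S) × Episode S A H =>
        g (Fin.cons (α := fun _ => Step S A) (s, a, p.1) p.2) := hg.comp <|
      hc.comp ((measurable_const.prodMk (measurable_const.prodMk measurable_fst)).prodMk
        measurable_snd)
    have hm' : Measurable fun z : ℝ × S => ∫⁻ ω,
        g (Fin.cons (α := fun _ => Step S A) (s, a, z) ω)
          ∂(M'.tail.episodeKernel (tailPolicy π, z.2)) := by
      have := (Measurable.lintegral_kernel_prod_right'
        (κ := M'.tail.episodeKernel.comap (fun z : ℝ × S => (tailPolicy π, z.2))
          (measurable_const.prodMk measurable_snd)) hm)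
      exact this
    -- The inner integral passes to `M'.tail` by induction; then the law of the first outcome is
    -- exchanged.
    refine le_trans (lintegral_mono fun z => ?_)
      (lintegral_mul_exp_neg_llr_le (hM.outcomeLaw 0 s a) hm')
    have key : ∀ ω : Episode S A H,
        g (Fin.cons (α := fun _ => Step S A) (s, a, z) ω) * ENNReal.ofReal (Real.exp
          (-M.episodeLLR M' (Fin.cons (α := fun _ => Step S A) (s, a, z) ω))) =
        g (Fin.cons (α := fun _ => Step S A) (s, a, z) ω) *
          ENNReal.ofReal (Real.exp (-M.tail.episodeLLR M'.tail ω)) *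
          ENNReal.ofReal (Real.exp (-llr (M.outcomeLaw 0 s a) (M'.outcomeLaw 0 s a) z)) := by
      intro ω
      rw [mul_assoc, ← ENNReal.ofReal_mul (Real.exp_pos _).le, ← Real.exp_add]
      congr 3
      rw [episodeLLR, Fin.sum_univ_succ, neg_add_rev]
      rfl
    simp_rw [key]
    rw [lintegral_mul_const _ ?_]
    · exact mul_le_mul' (lintegral_mul_exp_neg_episodeLLR_le htail _ _
        (hm.comp (measurable_const.prodMk measurable_id))) le_rfl
    · exact (hm.comp (measurable_const.prodMk measurable_id)).mul
        ((measurable_episodeLLR _ _).neg.exp.ennreal_ofReal)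

theorem visitation_le_one (M : MDP S A H) (s₀ : S) (π : Policy S A H) (h : Fin H) (s : S)
    (a : A) : M.visitation s₀ π h s a ≤ 1 :=
  prob_le_one (μ := M.episodeKernel (π, s₀))

theorem visitation_ne_top (M : MDP S A H) (s₀ : S) (π : Policy S A H) (h : Fin H) (s : S)
    (a : A) : M.visitation s₀ π h s a ≠ ⊤ :=
  ((visitation_le_one M s₀ π h s a).trans_lt ENNReal.one_lt_top).ne

/-- Visitation probabilities are at most one. The bound is uniform in the policy because the policy
explored is random. -/
theorem lintegral_enorm_episodeLLR_le {M M' : MDP S A H} (hM : M.AbsCont M') (s₀ : S) :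
    ∃ C : ℝ≥0∞, C ≠ ⊤ ∧ ∀ π : Policy S A H,
      ∫⁻ ω, ‖M.episodeLLR M' ω‖ₑ ∂(M.episodeKernel (π, s₀)) ≤ C := by
  refine ⟨∑ h, ∑ s, ∑ a, ∫⁻ z, ‖llr (M.outcomeLaw h s a) (M'.outcomeLaw h s a) z‖ₑ
    ∂(M.outcomeLaw h s a), ?_, fun π => ?_⟩
  · simp only [ne_eq, ENNReal.sum_eq_top, not_exists, not_and]
    exact fun h _ s _ a _ => (integrable_llr_outcomeLaw hM h s a).2.ne
  · calc ∫⁻ ω, ‖M.episodeLLR M' ω‖ₑ ∂(M.episodeKernel (π, s₀))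
        ≤ ∫⁻ ω, ∑ h, ‖llr (M.outcomeLaw h (ω h).1 (ω h).2.1)
            (M'.outcomeLaw h (ω h).1 (ω h).2.1) (ω h).2.2‖ₑ ∂(M.episodeKernel (π, s₀)) :=
          lintegral_mono fun ω => enorm_sum_le _ _
      _ = ∑ h, ∑ s, ∑ a, M.visitation s₀ π h s a * ∫⁻ z,
            ‖llr (M.outcomeLaw h s a) (M'.outcomeLaw h s a) z‖ₑ ∂(M.outcomeLaw h s a) := by
          refine (lintegral_finsetSum _ fun h _ =>
            ((measurable_stepLLR M M' h).comp (measurable_pi_apply h)).enorm).trans ?_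
          exact Finset.sum_congr rfl fun h _ =>
            lintegral_episodeKernel_step M s₀ π h (measurable_stepLLR M M' h).enorm
      _ ≤ _ := by
          gcongr with h _ s _ a
          exact mul_le_of_le_one_left' (visitation_le_one M s₀ π h s a)

/-- The expected log-likelihood ratio of an episode is the sum of the divergences, weighted by
the visitation probabilities. -/
theorem integral_episodeLLR {M M' : MDP S A H} (hM : M.AbsCont M') (s₀ : S)
    (π : Policy S A H) :
    ENNReal.ofReal (∫ ω, M.episodeLLR M' ω ∂(M.episodeKernel (π, s₀))) =
      ∑ h, ∑ s, ∑ a, M.visitation s₀ π h s a * M.kl M' h s a := by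
  have hstep : ∀ h s a, Integrable (fun x : Step S A =>
      llr (M.outcomeLaw h x.1 x.2.1) (M'.outcomeLaw h x.1 x.2.1) x.2.2)
      (M.visitation s₀ π h s a • (M.outcomeLaw h s a).map (fun z => (s, a, z))) := by
    intro h s a
    refine Integrable.smul_measure ?_ (visitation_ne_top M s₀ π h s a)
    rw [integrable_map_measure (measurable_stepLLR M M' h).aestronglyMeasurable (by fun_prop)]
    exact integrable_llr_outcomeLaw hM h s a
  have hint : ∀ h, Integrable (fun x : Step S A =>
      llr (M.outcomeLaw h x.1 x.2.1) (M'.outcomeLaw h x.1 x.2.1) x.2.2)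
      ((M.episodeKernel (π, s₀)).map (fun ω => ω h)) := by
    intro h
    rw [map_episodeKernel_step]
    exact integrable_finsetSum_measure.2 fun s _ =>
      integrable_finsetSum_measure.2 fun a _ => hstep h s a
  have key : ∫ ω, M.episodeLLR M' ω ∂(M.episodeKernel (π, s₀)) =
      ∑ h, ∑ s, ∑ a, (M.visitation s₀ π h s a * M.kl M' h s a).toReal := by
    refine (integral_finsetSum _ fun h _ =>
      (hint h).comp_measurable (measurable_pi_apply h)).trans ?_
    refine Finset.sum_congr rfl fun h _ => ?_
    refine (integral_map (φ := fun ω : Episode S A H => ω h)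
      (measurable_pi_apply h).aemeasurable
      (measurable_stepLLR M M' h).aestronglyMeasurable).symm.trans ?_
    rw [map_episodeKernel_step, integral_finsetSum_measure fun s _ =>
        integrable_finsetSum_measure.2 fun a _ => hstep h s a]
    refine Finset.sum_congr rfl fun s _ => ?_
    rw [integral_finsetSum_measure fun a _ => hstep h s a]
    refine Finset.sum_congr rfl fun a _ => ?_
    rw [integral_smul_measure, integral_map (by fun_prop)
      (measurable_stepLLR M M' h).aestronglyMeasurable, ENNReal.toReal_mul,
      ← integral_llr_outcomeLaw hM, smul_eq_mul]
  rw [key, ENNReal.ofReal_sum_of_nonneg fun h _ => by positivity]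
  refine Finset.sum_congr rfl fun h _ => ?_
  rw [ENNReal.ofReal_sum_of_nonneg fun s _ => by positivity]
  refine Finset.sum_congr rfl fun s _ => ?_
  rw [ENNReal.ofReal_sum_of_nonneg fun a _ => by positivity]
  refine Finset.sum_congr rfl fun a _ => ?_
  exact ENNReal.ofReal_toReal (ENNReal.mul_ne_top (visitation_ne_top M s₀ π h s a)
    (kl_ne_top hM h s a))

end MDP

/-! ### Change of measure for adaptive processes -/

namespace AdaptiveProcess

open Preorder Filter Topology

variable {X : ℕ → Type*} [∀ n, MeasurableSpace (X n)]

/-- Append the observation at time `n + 1` to a history up to time `n`. -/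
def snocHistory (n : ℕ) (p : ((i : Finset.Iic n) → X i) × X (n + 1)) :
    (i : Finset.Iic (n + 1)) → X i :=
  IicProdIoc n (n + 1) (p.1, MeasurableEquiv.piSingleton n p.2)

theorem measurable_snocHistory (n : ℕ) : Measurable (snocHistory (X := X) n) :=
  measurable_IicProdIoc.comp
    (measurable_fst.prodMk ((MeasurableEquiv.piSingleton n).measurable.comp measurable_snd))

theorem snocHistory_frestrictLe (n : ℕ) (ω : (n : ℕ) → X n) :
    snocHistory n (frestrictLe n ω, ω (n + 1)) = frestrictLe (n + 1) ω := by
  ext ⟨i, hi⟩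
  by_cases h : i ≤ n
  · simp [snocHistory, IicProdIoc, h]
  · have : i = n + 1 := by have := Finset.mem_Iic.1 hi; omega
    subst this
    simp [snocHistory, IicProdIoc, MeasurableEquiv.piSingleton]

/-- The accumulated log-likelihood ratio after `n` observations. -/
def pathLLR (l : (n : ℕ) → X (n + 1) → ℝ) (n : ℕ) (ω : (n : ℕ) → X n) : ℝ :=
  ∑ t ∈ range n, l t (ω (t + 1))

/-- The accumulated log-likelihood ratio as a function of the history. -/
def historyLLR (l : (n : ℕ) → X (n + 1) → ℝ) (n : ℕ) (x : (i : Finset.Iic n) → X i) : ℝ :=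
  ∑ t : Fin n, l t (x ⟨t + 1, Finset.mem_Iic.2 t.2⟩)

theorem historyLLR_frestrictLe (l : (n : ℕ) → X (n + 1) → ℝ) (n : ℕ) (ω : (n : ℕ) → X n) :
    historyLLR l n (frestrictLe n ω) = pathLLR l n ω :=
  (Finset.sum_range fun t => l t (ω (t + 1))).symm

theorem measurable_historyLLR {l : (n : ℕ) → X (n + 1) → ℝ} (hl : ∀ n, Measurable (l n)) (n : ℕ) :
    Measurable (historyLLR l n) :=
  Finset.measurable_sum _ fun t _ => (hl t).comp (measurable_pi_apply _)

theorem measurable_pathLLR {l : (n : ℕ) → X (n + 1) → ℝ} (hl : ∀ n, Measurable (l n)) (n : ℕ) :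
    Measurable (pathLLR l n) :=
  Finset.measurable_sum _ fun t _ => (hl t).comp (measurable_pi_apply _)

variable {μ₀ : Measure (X 0)} [IsProbabilityMeasure μ₀]
  {κ κ' : (n : ℕ) → Kernel ((i : Finset.Iic n) → X i) (X (n + 1))}
  [∀ n, IsMarkovKernel (κ n)] [∀ n, IsMarkovKernel (κ' n)]

theorem lintegral_trajMeasure_succ (n : ℕ) {f : ((i : Finset.Iic n) → X i) × X (n + 1) → ℝ≥0∞}
    (hf : Measurable f) :
    ∫⁻ ω, f (frestrictLe n ω, ω (n + 1)) ∂(Kernel.trajMeasure μ₀ κ) =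
      ∫⁻ ω, ∫⁻ y, f (frestrictLe n ω, y) ∂(κ n (frestrictLe n ω))
        ∂(Kernel.trajMeasure μ₀ κ) := by
  have h := Kernel.map_frestrictLe_trajMeasure_compProd_eq_map_trajMeasure (μ₀ := μ₀) (κ := κ)
    (a := n)
  have hm : Measurable fun ω : (n : ℕ) → X n => (frestrictLe (π := X) n ω, ω (n + 1)) := by
    fun_prop
  rw [← lintegral_map hf hm, ← h, Measure.lintegral_compProd hf, lintegral_map
    hf.lintegral_kernel_prod_right' (by fun_prop)]

/-- Both processes start from the same law; this is the base case of the change of measure. -/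
theorem map_frestrictLe_zero_trajMeasure :
    (Kernel.trajMeasure μ₀ κ).map (frestrictLe 0) =
      (Kernel.trajMeasure μ₀ κ').map (frestrictLe 0) := by
  rw [Kernel.trajMeasure, Kernel.trajMeasure, Measure.map_comp _ _ (by fun_prop),
    Measure.map_comp _ _ (by fun_prop), Kernel.traj_map_frestrictLe, Kernel.traj_map_frestrictLe,
    Kernel.partialTraj_self, Kernel.partialTraj_self]

variable {l : (n : ℕ) → X (n + 1) → ℝ}

/-- Change of measure: the likelihood ratio of `n` observations is a density (up to mass on which
the first law vanishes). -/
theorem lintegral_mul_exp_neg_pathLLR_le (hl : ∀ n, Measurable (l n))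
    (hκ : ∀ n x (g : X (n + 1) → ℝ≥0∞), Measurable g →
      ∫⁻ y, g y * ENNReal.ofReal (Real.exp (-l n y)) ∂(κ n x) ≤ ∫⁻ y, g y ∂(κ' n x)) :
    ∀ (n : ℕ) {g : ((i : Finset.Iic n) → X i) → ℝ≥0∞} (_ : Measurable g),
    ∫⁻ ω, g (frestrictLe n ω) * ENNReal.ofReal (Real.exp (-pathLLR l n ω))
        ∂(Kernel.trajMeasure μ₀ κ) ≤
      ∫⁻ ω, g (frestrictLe n ω) ∂(Kernel.trajMeasure μ₀ κ')
  | 0, g, hg => by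
    simp only [pathLLR, range_zero, sum_empty, neg_zero, Real.exp_zero, ENNReal.ofReal_one,
      mul_one]
    refine le_of_eq ((lintegral_map hg (by fun_prop)).symm.trans ?_)
    rw [map_frestrictLe_zero_trajMeasure (κ' := κ'), lintegral_map hg (by fun_prop)]
  | n + 1, g, hg => by
    have hs := measurable_snocHistory (X := X) n
    have hh := measurable_historyLLR hl n
    have hG : Measurable fun x : (i : Finset.Iic n) → X i =>
        ∫⁻ y, g (snocHistory n (x, y)) ∂(κ' n x) :=
      (hg.comp hs).lintegral_kernel_prod_right'
    calc ∫⁻ ω, g (frestrictLe (n + 1) ω) * ENNReal.ofReal (Real.exp (-pathLLR l (n + 1) ω))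
          ∂(Kernel.trajMeasure μ₀ κ)
        = ∫⁻ ω, g (snocHistory n (frestrictLe n ω, ω (n + 1))) * (ENNReal.ofReal (Real.exp
            (-l n (ω (n + 1)))) * ENNReal.ofReal (Real.exp (-historyLLR l n (frestrictLe n ω))))
            ∂(Kernel.trajMeasure μ₀ κ) := by
          refine lintegral_congr fun ω => ?_
          rw [snocHistory_frestrictLe, historyLLR_frestrictLe,
            ← ENNReal.ofReal_mul (Real.exp_pos _).le, ← Real.exp_add, pathLLR,
            Finset.sum_range_succ, neg_add_rev, pathLLR]
      _ = ∫⁻ ω, (∫⁻ y, g (snocHistory n (frestrictLe n ω, y)) * (ENNReal.ofReal (Real.exp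
            (-l n y)) * ENNReal.ofReal (Real.exp (-historyLLR l n (frestrictLe n ω))))
            ∂(κ n (frestrictLe n ω))) ∂(Kernel.trajMeasure μ₀ κ) :=
          lintegral_trajMeasure_succ n (f := fun p => g (snocHistory n p) * (ENNReal.ofReal
            (Real.exp (-l n p.2)) * ENNReal.ofReal (Real.exp (-historyLLR l n p.1))))
            (by fun_prop)
      -- The factor of the past depends on the history only and leaves the inner integral, where
      -- `hκ` replaces `κ n` by `κ' n`.
      _ ≤ ∫⁻ ω, (∫⁻ y, g (snocHistory n (frestrictLe n ω, y)) ∂(κ' n (frestrictLe n ω))) *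
            ENNReal.ofReal (Real.exp (-pathLLR l n ω)) ∂(Kernel.trajMeasure μ₀ κ) := by
          refine lintegral_mono fun ω => ?_
          have hg' : Measurable fun y => g (snocHistory n (frestrictLe n ω, y)) := by fun_prop
          simp_rw [← mul_assoc]
          rw [lintegral_mul_const _ (by fun_prop), historyLLR_frestrictLe]
          exact mul_le_mul' (hκ n _ _ hg') le_rfl
      _ ≤ ∫⁻ ω, (∫⁻ y, g (snocHistory n (frestrictLe n ω, y)) ∂(κ' n (frestrictLe n ω)))
            ∂(Kernel.trajMeasure μ₀ κ') := lintegral_mul_exp_neg_pathLLR_le hl hκ n hG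
      _ = ∫⁻ ω, g (frestrictLe (n + 1) ω) ∂(Kernel.trajMeasure μ₀ κ') := by
          rw [← lintegral_trajMeasure_succ n (f := fun p => g (snocHistory n p)) (hg.comp hs)]
          simp_rw [snocHistory_frestrictLe]

/-- Change of measure at a bounded stopping time. -/
theorem lintegral_stopped_mul_exp_neg_pathLLR_le (hl : ∀ n, Measurable (l n))
    (hκ : ∀ n x (g : X (n + 1) → ℝ≥0∞), Measurable g →
      ∫⁻ y, g y * ENNReal.ofReal (Real.exp (-l n y)) ∂(κ n x) ≤ ∫⁻ y, g y ∂(κ' n x))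
    {N : ℕ} {σ : ((n : ℕ) → X n) → ℕ} (hσN : ∀ ω, σ ω ≤ N)
    {C : (n : ℕ) → Set ((i : Finset.Iic n) → X i)} (hC : ∀ n, MeasurableSet (C n))
    (hσC : ∀ n ω, n ≤ N → (σ ω = n ↔ frestrictLe n ω ∈ C n))
    {g : (n : ℕ) → ((i : Finset.Iic n) → X i) → ℝ≥0∞} (hg : ∀ n, Measurable (g n)) :
    ∫⁻ ω, g (σ ω) (frestrictLe (σ ω) ω) * ENNReal.ofReal (Real.exp (-pathLLR l (σ ω) ω))
        ∂(Kernel.trajMeasure μ₀ κ) ≤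
      ∫⁻ ω, g (σ ω) (frestrictLe (σ ω) ω) ∂(Kernel.trajMeasure μ₀ κ') := by
  have hm : ∀ n, Measurable ((C n).indicator (g n)) := fun n => (hg n).indicator (hC n)
  have hp := measurable_pathLLR hl
  -- Decomposition over the value of `σ`, which reduces the claim to fixed times. The factor `e` is
  -- arbitrary so that both sides are covered: the exponential on the left, `1` on the right.
  have hsplit : ∀ (e : ℕ → ((n : ℕ) → X n) → ℝ≥0∞) (ω : (n : ℕ) → X n),
      g (σ ω) (frestrictLe (σ ω) ω) * e (σ ω) ω =
        ∑ n ∈ range (N + 1), (C n).indicator (g n) (frestrictLe n ω) * e n ω := by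
    intro e ω
    rw [Finset.sum_eq_single (σ ω), Set.indicator_of_mem ((hσC _ ω (hσN ω)).1 rfl)]
    · intro n hn hne
      have : frestrictLe n ω ∉ C n := fun h => hne
        ((hσC n ω (Nat.lt_succ_iff.1 (Finset.mem_range.1 hn))).2 h).symm
      rw [Set.indicator_of_notMem this, zero_mul]
    · intro h
      exact absurd (Finset.mem_range.2 (Nat.lt_succ_of_le (hσN ω))) h
  have h1 := hsplit fun n ω => ENNReal.ofReal (Real.exp (-pathLLR l n ω))
  have h2 := hsplit fun _ _ => 1
  simp only [mul_one] at h2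
  simp_rw [h1, h2]
  rw [lintegral_finsetSum _ (fun n _ => by fun_prop),
    lintegral_finsetSum _ (fun n _ => by fun_prop)]
  exact Finset.sum_le_sum fun n _ => lintegral_mul_exp_neg_pathLLR_le hl hκ n (hm n)

/-- The contribution of one time step to the expected log-likelihood ratio of a process that is
observed as long as the history lies in `B`. -/
theorem integrable_indicator_llr {C : ℝ≥0∞} (hC : C ≠ ⊤) (n : ℕ) (hl : Measurable (l n))
    (hlC : ∀ x, ∫⁻ y, ‖l n y‖ₑ ∂(κ n x) ≤ C) {B : Set ((i : Finset.Iic n) → X i)}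
    (hB : MeasurableSet B) :
    Integrable (fun ω : (n : ℕ) → X n => B.indicator (fun _ => l n (ω (n + 1)))
      (frestrictLe n ω)) (Kernel.trajMeasure μ₀ κ) := by
  have hm : Measurable fun p : ((i : Finset.Iic n) → X i) × X (n + 1) =>
      (Prod.fst ⁻¹' B).indicator (fun p => l n p.2) p :=
    (hl.comp measurable_snd).indicator (measurable_fst hB)
  have heq : (fun ω : (n : ℕ) → X n => B.indicator (fun _ => l n (ω (n + 1)))
      (frestrictLe n ω)) = fun ω => (Prod.fst ⁻¹' B).indicator
        (fun p : ((i : Finset.Iic n) → X i) × X (n + 1) => l n p.2)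
        (frestrictLe n ω, ω (n + 1)) := rfl
  rw [heq]
  refine ⟨(hm.comp (by fun_prop : Measurable fun ω : (n : ℕ) → X n =>
    (frestrictLe (π := X) n ω, ω (n + 1)))).aestronglyMeasurable, ?_⟩
  rw [HasFiniteIntegral, lintegral_trajMeasure_succ (μ₀ := μ₀) (κ := κ) n hm.enorm]
  refine lt_of_le_of_lt (b := ∫⁻ _, C ∂(Kernel.trajMeasure μ₀ κ)) (lintegral_mono fun ω =>
    (lintegral_mono fun y => ?_).trans (hlC (frestrictLe n ω))) (by simpa using hC.lt_top)
  exact enorm_indicator_le_enorm_self _ _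

theorem ofReal_integral_le_lintegral_ofReal {α : Type*} [MeasurableSpace α] {μ : Measure α}
    {f : α → ℝ} (hf : Integrable f μ) :
    ENNReal.ofReal (∫ x, f x ∂μ) ≤ ∫⁻ x, ENNReal.ofReal (f x) ∂μ := by
  rw [integral_eq_lintegral_pos_part_sub_lintegral_neg_part hf]
  refine (ENNReal.ofReal_le_ofReal (sub_le_self _ ENNReal.toReal_nonneg)).trans
    ENNReal.ofReal_toReal_le

/-- One term of Wald's identity: given a history in `B`, the conditional mean of the new log-ratio
is controlled by `k`. -/
theorem ofReal_integral_indicator_llr_le {C : ℝ≥0∞} (hC : C ≠ ⊤) (n : ℕ) (hl : Measurable (l n))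
    (hlC : ∀ x, ∫⁻ y, ‖l n y‖ₑ ∂(κ n x) ≤ C) {B : Set ((i : Finset.Iic n) → X i)}
    (hB : MeasurableSet B) {k : ((i : Finset.Iic n) → X i) → ℝ≥0∞}
    (hk : ∀ x, ENNReal.ofReal (∫ y, l n y ∂(κ n x)) ≤ k x) :
    ENNReal.ofReal (∫ ω, B.indicator (fun _ => l n (ω (n + 1))) (frestrictLe n ω)
        ∂(Kernel.trajMeasure μ₀ κ)) ≤
      ∫⁻ ω, B.indicator k (frestrictLe n ω) ∂(Kernel.trajMeasure μ₀ κ) := by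
  have hint := integrable_indicator_llr (μ₀ := μ₀) (κ := κ) hC n hl hlC hB
  have hm : Measurable fun p : ((i : Finset.Iic n) → X i) × X (n + 1) =>
      B.indicator (fun _ => l n p.2) p.1 :=
    (hl.comp measurable_snd).indicator ((measurable_fst (β := X (n + 1))) hB)
  have hpair : Measurable fun ω : (n : ℕ) → X n => (frestrictLe (π := X) n ω, ω (n + 1)) := by
    fun_prop
  have hmap := Kernel.map_frestrictLe_trajMeasure_compProd_eq_map_trajMeasure (μ₀ := μ₀)
    (κ := κ) (a := n)
  have hint' : Integrable (fun p : ((i : Finset.Iic n) → X i) × X (n + 1) =>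
      B.indicator (fun _ => l n p.2) p.1) ((Kernel.trajMeasure μ₀ κ).map (frestrictLe n) ⊗ₘ κ n) := by
    rw [hmap, integrable_map_measure hm.aestronglyMeasurable hpair.aemeasurable]
    exact hint
  have h1 := integral_map (μ := Kernel.trajMeasure μ₀ κ) hpair.aemeasurable
    hm.aestronglyMeasurable
  rw [← hmap, Measure.integral_compProd hint'] at h1
  rw [← h1]
  -- The composition-product of a measure and a kernel is read as one of kernels over `Unit`.
  refine (ofReal_integral_le_lintegral_ofReal (Integrable.integral_compProd
    (κ := Kernel.const Unit _) (η := Kernel.prodMkLeft Unit (κ n)) (a := ()) hint')).trans ?_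
  refine (lintegral_map_le _ _).trans (lintegral_mono fun ω => ?_)
  by_cases h : frestrictLe n ω ∈ B
  · simpa [h] using hk _
  · simp [h]

end AdaptiveProcess

/-! ### Transport inequality at a stopping time -/

namespace AdaptiveProcess

open Preorder Filter Topology

section Transport

variable {X : ℕ → Type*} [∀ n, MeasurableSpace (X n)]

/-- The event that the process has stopped by time `N`, with a history in `R`. -/
def stoppedIn (τ : ((n : ℕ) → X n) → WithTop ℕ) (R : (n : ℕ) → Set ((i : Finset.Iic n) → X i))
    (N : ℕ) : Set ((n : ℕ) → X n) :=
  {ω | ∃ n ≤ N, τ ω = (n : ℕ) ∧ frestrictLe n ω ∈ R n}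

variable {τ : ((n : ℕ) → X n) → WithTop ℕ} {R : (n : ℕ) → Set ((i : Finset.Iic n) → X i)}

theorem exists_preimage_frestrictLe {n : ℕ} {s : Set ((n : ℕ) → X n)}
    (hs : MeasurableSet[Filtration.piLE (X := X) n] s) :
    ∃ B : Set ((i : Finset.Iic n) → X i), MeasurableSet B ∧ frestrictLe n ⁻¹' B = s := by
  rw [Filtration.piLE_eq_comap_frestrictLe] at hs
  exact hs

theorem measurableSet_stoppedIn (hτ : IsStoppingTime (Filtration.piLE (X := X)) τ)
    (hR : ∀ n, MeasurableSet (R n)) (N : ℕ) : MeasurableSet (stoppedIn τ R N) := by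
  have : stoppedIn τ R N = ⋃ n ∈ Set.Iic N, {ω | τ ω = (n : ℕ)} ∩ frestrictLe n ⁻¹' R n := by
    ext ω
    simp only [stoppedIn, Set.mem_ofPred_eq, Set.mem_iUnion, Set.mem_inter_iff, Set.mem_preimage,
      Set.mem_Iic, exists_prop]
  rw [this]
  refine MeasurableSet.biUnion (Set.to_countable _) fun n _ => MeasurableSet.inter ?_ ?_
  · exact Filtration.le _ n _ (hτ.measurableSet_eq n)
  · exact (by fun_prop : Measurable (frestrictLe (π := X) n)) (hR n)

variable {μ₀ : Measure (X 0)} [IsProbabilityMeasure μ₀]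
  {κ κ' : (n : ℕ) → Kernel ((i : Finset.Iic n) → X i) (X (n + 1))}
  [∀ n, IsMarkovKernel (κ n)] [∀ n, IsMarkovKernel (κ' n)] {l : (n : ℕ) → X (n + 1) → ℝ}

theorem lintegral_exp_stoppedIn_le (hτ : IsStoppingTime (Filtration.piLE (X := X)) τ)
    (hR : ∀ n, MeasurableSet (R n)) (hl : ∀ n, Measurable (l n))
    (hκ : ∀ n x (g : X (n + 1) → ℝ≥0∞), Measurable g →
      ∫⁻ y, g y * ENNReal.ofReal (Real.exp (-l n y)) ∂(κ n x) ≤ ∫⁻ y, g y ∂(κ' n x))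
    {B : (n : ℕ) → Set ((i : Finset.Iic n) → X i)}
    (hB : ∀ (n : ℕ) ω, frestrictLe n ω ∈ B n ↔ (n : WithTop ℕ) < τ ω) (N : ℕ) (a b : ℝ≥0∞)
    [DecidablePred (· ∈ stoppedIn τ R N)] :
    ∫⁻ ω, (if ω ∈ stoppedIn τ R N then a else b) * ENNReal.ofReal (Real.exp
        (-∑ t ∈ range N, (B t).indicator (fun _ => l t (ω (t + 1))) (frestrictLe t ω)))
        ∂(Kernel.trajMeasure μ₀ κ) ≤
      ∫⁻ ω, (if ω ∈ stoppedIn τ R N then a else b) ∂(Kernel.trajMeasure μ₀ κ') := by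
  classical
  choose D hD hDτ using fun n => exists_preimage_frestrictLe (hτ.measurableSet_eq n)
  choose G hG hGτ using fun n => exists_preimage_frestrictLe (hτ.measurableSet_ge n)
  have hDτ' : ∀ (n : ℕ) ω, frestrictLe n ω ∈ D n ↔ τ ω = n := fun n ω =>
    Set.ext_iff.1 (hDτ n) ω
  have hGτ' : ∀ (n : ℕ) ω, frestrictLe n ω ∈ G n ↔ (n : WithTop ℕ) ≤ τ ω := fun n ω =>
    Set.ext_iff.1 (hGτ n) ω
  -- The bounded stopping time is `σ = min τ N`.
  have hex : ∀ ω, ∃ m : ℕ, (m : WithTop ℕ) = min (τ ω) N := fun ω =>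
    WithTop.ne_top_iff_exists.1 (ne_top_of_le_ne_top (WithTop.coe_ne_top (a := N))
      (min_le_right _ _))
  choose σ hσ using hex
  have hσN : ∀ ω, σ ω ≤ N := fun ω => by
    have := (hσ ω).le.trans (min_le_right _ _)
    exact_mod_cast this
  have hmain := lintegral_stopped_mul_exp_neg_pathLLR_le (μ₀ := μ₀) hl hκ hσN
    -- Below `N`, `σ = n` means `τ = n`; at `n = N` it means `N ≤ τ`.
    (C := fun n => if n < N then D n else G n) (fun n => by split_ifs <;> simp [hD, hG])
    (fun n ω hn => by
      rcases hn.lt_or_eq with h | rfl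
      · simp only [h, if_true, hDτ']
        rw [← Nat.cast_inj (R := WithTop ℕ), hσ]
        have h' : (n : WithTop ℕ) < N := by exact_mod_cast h
        rcases le_total (τ ω) N with h1 | h1
        · rw [min_eq_left h1]
        · rw [min_eq_right h1]
          exact ⟨fun h2 => absurd h2 h'.ne', fun h2 => absurd h' (by rw [← h2]; exact h1.not_gt)⟩
      · simp only [lt_irrefl, if_false, hGτ']
        rw [← Nat.cast_inj (R := WithTop ℕ), hσ]
        exact min_eq_right_iff)
    (g := fun n x => if x ∈ D n ∩ R n then a else b)
    (fun n => Measurable.ite ((hD n).inter (hR n)) measurable_const measurable_const)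
  -- The history at `σ` decides the event: if `τ ≤ N` then `σ = τ`, and otherwise `D (σ ω)` fails.
  have hE : ∀ ω, frestrictLe (σ ω) ω ∈ D (σ ω) ∩ R (σ ω) ↔ ω ∈ stoppedIn τ R N := by
    intro ω
    rw [Set.mem_inter_iff, hDτ']
    constructor
    · exact fun h => ⟨σ ω, hσN ω, h⟩
    · rintro ⟨n, hn, hτn, hR⟩
      have : σ ω = n := by
        have h1 := hσ ω
        rw [hτn, min_eq_left (by exact_mod_cast hn)] at h1
        exact_mod_cast h1
      rw [this]
      exact ⟨hτn, hR⟩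
  have hL : ∀ ω, pathLLR l (σ ω) ω =
      ∑ t ∈ range N, (B t).indicator (fun _ => l t (ω (t + 1))) (frestrictLe t ω) := by
    intro ω
    simp only [Set.indicator_apply, hB]
    rw [← Finset.sum_filter, pathLLR]
    refine Finset.sum_congr ?_ fun _ _ => rfl
    ext t
    rw [Finset.mem_range, Finset.mem_filter, Finset.mem_range, ← Nat.cast_lt (α := WithTop ℕ), hσ,
      lt_min_iff, and_comm]
    refine and_congr ?_ Iff.rfl
    exact_mod_cast Iff.rfl
  simp only [hE, hL] at hmain
  convert hmain

/-- The transport inequality for an adaptive process stopped at `τ`: if an event of the stopped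
process has probability at least `1 - δ` under the first law and at most `δ` under the second,
then the expected log-likelihood ratio is at least the binary relative entropy of `1 - δ` and
`δ`. -/
theorem binary_relative_entropy_le_tsum (hτ : IsStoppingTime (Filtration.piLE (X := X)) τ)
    (hR : ∀ n, MeasurableSet (R n)) (hl : ∀ n, Measurable (l n))
    (hκ : ∀ n x (g : X (n + 1) → ℝ≥0∞), Measurable g →
      ∫⁻ y, g y * ENNReal.ofReal (Real.exp (-l n y)) ∂(κ n x) ≤ ∫⁻ y, g y ∂(κ' n x))
    {C : ℝ≥0∞} (hC : C ≠ ⊤) (hlC : ∀ n x, ∫⁻ y, ‖l n y‖ₑ ∂(κ n x) ≤ C)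
    {k : (n : ℕ) → ((i : Finset.Iic n) → X i) → ℝ≥0∞}
    (hk : ∀ n x, ENNReal.ofReal (∫ y, l n y ∂(κ n x)) ≤ k n x)
    {δ : ℝ} (hδ : 0 < δ) (hδ' : δ ≤ 1 / 2)
    (hE : Kernel.trajMeasure μ₀ κ {ω | ∃ n : ℕ, τ ω = n ∧ frestrictLe n ω ∈ R n}ᶜ ≤
      ENNReal.ofReal δ)
    (hE' : Kernel.trajMeasure μ₀ κ' {ω | ∃ n : ℕ, τ ω = n ∧ frestrictLe n ω ∈ R n} ≤
      ENNReal.ofReal δ) :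
    ENNReal.ofReal ((1 - 2 * δ) * Real.log ((1 - δ) / δ)) ≤
      ∑' n : ℕ, ∫⁻ ω, {ω | (n : WithTop ℕ) < τ ω}.indicator (fun ω => k n (frestrictLe n ω)) ω
        ∂(Kernel.trajMeasure μ₀ κ) := by
  classical
  set P := Kernel.trajMeasure μ₀ κ with hP
  set P' := Kernel.trajMeasure μ₀ κ' with hP'
  -- The log-likelihood ratio between Bernoulli laws of parameters `1 - δ` and `δ` is `lam` at
  -- success and `-lam` at failure; it serves as the test function `φ` below.
  set lam := Real.log ((1 - δ) / δ) with hlam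
  have hδ1 : 0 < 1 - δ := by linarith
  have hexp : Real.exp lam = (1 - δ) / δ := Real.exp_log (div_pos hδ1 hδ)
  have hexp' : Real.exp (-lam) = δ / (1 - δ) := by rw [Real.exp_neg, hexp, inv_div]
  have hlam0 : 0 ≤ lam := Real.log_nonneg (by rw [le_div_iff₀ hδ]; linarith)
  choose B hB hBτ using fun n => exists_preimage_frestrictLe (hτ.measurableSet_gt n)
  have hBτ' : ∀ (n : ℕ) ω, frestrictLe n ω ∈ B n ↔ (n : WithTop ℕ) < τ ω := fun n ω =>
    Set.ext_iff.1 (hBτ n) ω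
  have hEm := measurableSet_stoppedIn hτ hR
  have hEmono : Monotone (stoppedIn τ R) := fun m n hmn ω ⟨i, hi, h⟩ => ⟨i, hi.trans hmn, h⟩
  have hEunion : {ω | ∃ n : ℕ, τ ω = n ∧ frestrictLe n ω ∈ R n} = ⋃ N, stoppedIn τ R N := by
    ext ω
    simp only [stoppedIn, Set.mem_ofPred_eq, Set.mem_iUnion]
    exact ⟨fun ⟨n, h⟩ => ⟨n, n, le_rfl, h⟩, fun ⟨_, n, _, h⟩ => ⟨n, h⟩⟩
  set rhs := ∑' n : ℕ, ∫⁻ ω, {ω | (n : WithTop ℕ) < τ ω}.indicator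
    (fun ω => k n (frestrictLe n ω)) ω ∂P with hrhs
  -- Truncation at `N` makes the log-ratio a finite sum of integrable terms; only the left side
  -- depends on `N`.
  have hfin : ∀ N, ENNReal.ofReal (lam * (2 * P.real (stoppedIn τ R N) - 1)) ≤ rhs := by
    intro N
    set L : ((n : ℕ) → X n) → ℝ := fun ω =>
      ∑ t ∈ range N, (B t).indicator (fun _ => l t (ω (t + 1))) (frestrictLe t ω) with hLdef
    have hLt : ∀ t, Integrable (fun ω : (n : ℕ) → X n =>
        (B t).indicator (fun _ => l t (ω (t + 1))) (frestrictLe t ω)) P := fun t =>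
      integrable_indicator_llr hC t (hl t) (hlC t) (hB t)
    have hL : Integrable L P := integrable_finsetSum _ fun t _ => hLt t
    set φ : ((n : ℕ) → X n) → ℝ := fun ω =>
      (stoppedIn τ R N).indicator (fun _ => 2 * lam) ω - lam with hφdef
    have hφint : ∀ (Q : Measure ((n : ℕ) → X n)) [IsProbabilityMeasure Q], Integrable φ Q :=
      fun Q _ => ((integrable_const _).indicator (hEm N)).sub (integrable_const _)
    have hφ : ∫ ω, φ ω ∂P = lam * (2 * P.real (stoppedIn τ R N) - 1) := by
      rw [integral_sub ((integrable_const _).indicator (hEm N)) (integrable_const _),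
        integral_indicator_const _ (hEm N)]
      simp
      ring
    have hφexp : ∀ ω, ENNReal.ofReal (Real.exp (φ ω)) = if ω ∈ stoppedIn τ R N then
        ENNReal.ofReal ((1 - δ) / δ) else ENNReal.ofReal (δ / (1 - δ)) := by
      intro ω
      by_cases h : ω ∈ stoppedIn τ R N
      · simp only [φ, h, Set.indicator_of_mem, if_true, ← hexp]
        congr 2; ring
      · simp only [φ, h, Set.indicator_of_notMem, if_false, ← hexp', not_false_eq_true, zero_sub]
    have hP'E : P'.real (stoppedIn τ R N) ≤ δ := by
      refine ENNReal.toReal_le_of_le_ofReal hδ.le ((measure_mono ?_).trans hE')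
      rw [hEunion]
      exact Set.subset_iUnion _ N
    -- Since `δ ≤ 1/2`, the integral is nondecreasing in the probability of the event, and at
    -- probability `δ` it equals `(1 - δ) + δ = 1`.
    have hone : ∫⁻ ω, (if ω ∈ stoppedIn τ R N then
        ENNReal.ofReal ((1 - δ) / δ) else ENNReal.ofReal (δ / (1 - δ))) ∂P' ≤ 1 := by
      have hab : δ / (1 - δ) ≤ (1 - δ) / δ := by
        rw [div_le_div_iff₀ hδ1 hδ]; nlinarith
      have hint : Integrable (fun ω => (stoppedIn τ R N).indicator
          (fun _ => (1 - δ) / δ - δ / (1 - δ)) ω + δ / (1 - δ)) P' :=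
        ((integrable_const _).indicator (hEm N)).add (integrable_const _)
      have heq : ∀ ω, (if ω ∈ stoppedIn τ R N then
          ENNReal.ofReal ((1 - δ) / δ) else ENNReal.ofReal (δ / (1 - δ))) =
          ENNReal.ofReal ((stoppedIn τ R N).indicator
            (fun _ => (1 - δ) / δ - δ / (1 - δ)) ω + δ / (1 - δ)) := by
        intro ω
        by_cases h : ω ∈ stoppedIn τ R N <;> simp [h]
      simp_rw [heq]
      rw [← ofReal_integral_eq_lintegral_ofReal hint (ae_of_all _ fun ω => by
          have : 0 ≤ δ / (1 - δ) := by positivity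
          refine add_nonneg (Set.indicator_nonneg (fun _ _ => sub_nonneg.2 hab) _) this),
        ENNReal.ofReal_le_one, integral_add ((integrable_const _).indicator (hEm N))
          (integrable_const _), integral_indicator_const _ (hEm N)]
      simp only [smul_eq_mul, integral_const, probReal_univ, one_mul]
      calc P'.real (stoppedIn τ R N) * ((1 - δ) / δ - δ / (1 - δ)) + δ / (1 - δ)
          ≤ δ * ((1 - δ) / δ - δ / (1 - δ)) + δ / (1 - δ) := by
            gcongr
        _ = 1 := by field_simp; ring
    have hexpL : ∫⁻ ω, ENNReal.ofReal (Real.exp (φ ω - L ω)) ∂P ≤ 1 := by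
      refine le_trans (le_of_eq (lintegral_congr fun ω => ?_))
        ((lintegral_exp_stoppedIn_le (μ₀ := μ₀) hτ hR hl hκ hBτ' N (ENNReal.ofReal ((1 - δ) / δ))
          (ENNReal.ofReal (δ / (1 - δ)))).trans hone)
      rw [← hφexp, ← ENNReal.ofReal_mul (Real.exp_pos _).le, ← Real.exp_add, sub_eq_add_neg]
    have hmeas : AEStronglyMeasurable (fun ω => Real.exp (φ ω - L ω)) P :=
      Real.continuous_exp.comp_aestronglyMeasurable ((hφint P).sub hL).aestronglyMeasurable
    have hexpint : Integrable (fun ω => Real.exp (φ ω - L ω)) P := by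
      refine ⟨hmeas, ?_⟩
      rw [hasFiniteIntegral_iff_ofReal (ae_of_all _ fun ω => (Real.exp_pos _).le)]
      exact hexpL.trans_lt ENNReal.one_lt_top
    have hexple : ∫ ω, Real.exp (φ ω - L ω) ∂P ≤ 1 := by
      rw [integral_eq_lintegral_of_nonneg_ae (ae_of_all _ fun ω => (Real.exp_pos _).le) hmeas]
      exact ENNReal.toReal_le_of_le_ofReal zero_le_one (by simpa using hexpL)
    -- The bound `x + 1 ≤ exp x` at `x = φ - L` takes the place of Jensen's inequality.
    have hφL : ∫ ω, φ ω ∂P ≤ ∫ ω, L ω ∂P := by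
      have h1 : ∫ ω, (φ ω - L ω) ∂P ≤ ∫ ω, (Real.exp (φ ω - L ω) - 1) ∂P :=
        integral_mono ((hφint P).sub hL) (hexpint.sub (integrable_const _)) fun ω => by
          have := Real.add_one_le_exp (φ ω - L ω)
          simp only
          linarith
      rw [integral_sub (hφint P) hL, integral_sub hexpint (integrable_const _)] at h1
      simp only [integral_const, probReal_univ, one_smul] at h1
      linarith
    rw [← hφ]
    refine (ENNReal.ofReal_le_ofReal hφL).trans ?_
    rw [hLdef, integral_finsetSum _ fun t _ => hLt t]
    refine (Finset.le_sum_of_subadditive ENNReal.ofReal ENNReal.ofReal_zero.le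
      (fun _ _ => ENNReal.ofReal_add_le) _ _).trans ((Finset.sum_le_sum fun t _ => ?_).trans
      (ENNReal.sum_le_tsum (range N)))
    refine (ofReal_integral_indicator_llr_le hC t (hl t) (hlC t) (hB t) (hk t)).trans
      (le_of_eq ?_)
    refine lintegral_congr fun ω => ?_
    simp only [Set.indicator_apply, hBτ', Set.mem_ofPred_eq]
  -- Continuity of the measure along the increasing events `stoppedIn τ R N`.
  have htend : Tendsto (fun N => ENNReal.ofReal (lam * (2 * P.real (stoppedIn τ R N) - 1)))
      atTop (𝓝 (ENNReal.ofReal (lam * (2 * P.real (⋃ N, stoppedIn τ R N) - 1)))) := by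
    refine ENNReal.tendsto_ofReal (((((ENNReal.tendsto_toReal (measure_ne_top P _)).comp
      (tendsto_measure_iUnion_atTop hEmono)).const_mul 2).sub_const 1).const_mul lam)
  refine le_trans (ENNReal.ofReal_le_ofReal ?_) (le_of_tendsto' htend hfin)
  have h1 : P.real (⋃ N, stoppedIn τ R N)ᶜ ≤ δ := by
    rw [hEunion] at hE
    exact ENNReal.toReal_le_of_le_ofReal hδ.le hE
  rw [probReal_compl_eq_one_sub (MeasurableSet.iUnion hEm)] at h1
  rw [mul_comm]
  exact mul_le_mul_of_nonneg_left (by linarith) hlam0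

end Transport

end AdaptiveProcess

/-! ### Elementary estimates -/

/-- The gap is `(1 - 2δ) log(1 - δ) + 2δ log δ + log 2.4`. Both logarithms are bounded below by `1 -
1/x ≤ log x`, scaled to be sharp at `δ = 1/3`, near the minimum of the gap. Writing `2.4 =
(8/5)(3/2)`, the terms in `log 3` cancel, leaving `log(8/5) - 2δ log 2 - 1 + (2/3)/(1 - δ) ≥ 0`. -/
theorem log_inv_le_binary_relative_entropy {δ : ℝ} (hδ : 0 < δ) (hδ' : δ < 1 / 2) :
    Real.log (1 / (2.4 * δ)) ≤ (1 - 2 * δ) * Real.log ((1 - δ) / δ) := by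
  have hy : 0 < 1 - δ := by linarith
  have h1 : Real.log (1 / (2.4 * δ)) = -(Real.log (8 / 5) + (Real.log 3 - Real.log 2)) -
      Real.log δ := by
    have : (1 / (2.4 * δ) : ℝ) = (8 / 5 * (3 / 2) * δ)⁻¹ := by
      rw [one_div]
      congr 2
      norm_num
    rw [this, Real.log_inv, Real.log_mul (by norm_num) hδ.ne',
      Real.log_mul (by norm_num) (by norm_num), Real.log_div (by norm_num : (3 : ℝ) ≠ 0)
        (by norm_num)]
    ring
  have h2 := Real.one_sub_inv_le_log_of_pos (x := (1 - δ) / (2 / 3)) (by positivity)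
  have h3 := Real.one_sub_inv_le_log_of_pos (x := δ / (1 / 3)) (by positivity)
  rw [Real.log_div hy.ne' (by norm_num), Real.log_div (by norm_num) (by norm_num), inv_div] at h2
  rw [Real.log_div hδ.ne' (by norm_num), Real.log_div (by norm_num) (by norm_num), inv_div,
    Real.log_one] at h3
  have h4 : δ * (1 / 3 / δ) = 1 / 3 := by field_simp
  -- The fraction `23/34` is just below `log(8/5) / log 2`; it yields `log(8/5) ≥ 0.4688`.
  have h5 : (23 : ℝ) * Real.log 2 ≤ 34 * Real.log (8 / 5) := by
    have : Real.log ((2 : ℝ) ^ 23) ≤ Real.log ((8 / 5 : ℝ) ^ 34) :=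
      Real.log_le_log (by norm_num) (by norm_num)
    rw [Real.log_pow, Real.log_pow] at this
    exact_mod_cast this
  have h6 := Real.log_two_gt_d9
  have h7 := Real.log_two_lt_d9
  rw [h1, Real.log_div hy.ne' hδ.ne']
  have h8 : (1 - 2 * δ) * (2 / 3 / (1 - δ)) = 4 / 3 - 2 / 3 / (1 - δ) := by field_simp; ring
  -- After clearing the denominator this is quadratic in `δ`, with vertex near `0.3084`.
  have h9 : 1 - 0.4688 + 2 * δ * 0.6931471808 ≤ 2 / 3 / (1 - δ) := by
    rw [le_div_iff₀ hy]
    nlinarith [sq_nonneg (δ - 0.3084)]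
  have h10 := mul_le_mul_of_nonneg_left h2 (by linarith : 0 ≤ 1 - 2 * δ)
  have h11 := mul_le_mul_of_nonneg_left h3 hδ.le
  have h12 : δ * Real.log 2 ≤ δ * 0.6931471808 := by gcongr
  nlinarith

theorem toENNReal_eq_tsum (n : ℕ∞) :
    n.toENNReal = ∑' t : ℕ, {t : ℕ | (t : ℕ∞) < n}.indicator (fun _ => (1 : ℝ≥0∞)) t := by
  induction n with
  | top =>
    have : {t : ℕ | (t : ℕ∞) < ⊤} = Set.univ := by ext t; simp
    rw [this]
    simp
  | coe n =>
    rw [tsum_eq_sum (s := range n)]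
    · rw [Finset.sum_congr rfl (g := fun _ => 1)]
      · simp
      · intro t ht
        rw [Set.indicator_of_mem]
        simpa using ht
    · intro t ht
      rw [Set.indicator_of_notMem]
      simpa using ht

/-! ### Mixtures of Markovian policies -/

/-- The witness is the barycentre of `q`. The mass stays as a factor so that `ν = 0` is allowed,
where `q₀` is taken. -/
theorem exists_stdSimplex_mean {I : Type u} [Fintype I] {Ω : Type*} [MeasurableSpace Ω]
    {ν : Measure Ω} (hν : ν Set.univ ≠ ⊤) {q : Ω → stdSimplex ℝ I} (hq : Measurable q)
    (q₀ : stdSimplex ℝ I) :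
    ∃ p : stdSimplex ℝ I, ∀ i, ν Set.univ * ENNReal.ofReal ((p : I → ℝ) i) =
      ∫⁻ ω, ENNReal.ofReal ((q ω : I → ℝ) i) ∂ν := by
  have hm : ∀ i, Measurable fun ω => ENNReal.ofReal ((q ω : I → ℝ) i) := fun i =>
    ENNReal.measurable_ofReal.comp
      ((measurable_pi_apply i).comp (measurable_subtype_coe.comp hq))
  by_cases h0 : ν = 0
  · exact ⟨q₀, fun i => by simp [h0]⟩
  have h0' : ν Set.univ ≠ 0 := by simpa using h0
  have hsum : ∑ i, ∫⁻ ω, ENNReal.ofReal ((q ω : I → ℝ) i) ∂ν = ν Set.univ := by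
    rw [← lintegral_finsetSum _ fun i _ => hm i]
    rw [← lintegral_one]
    refine lintegral_congr fun ω => ?_
    exact (ENNReal.ofReal_sum_of_nonneg fun i _ => (q ω).2.1 i).symm.trans <|
      (congrArg ENNReal.ofReal (q ω).2.2).trans ENNReal.ofReal_one
  have hle : ∀ i, ∫⁻ ω, ENNReal.ofReal ((q ω : I → ℝ) i) ∂ν ≠ ⊤ := fun i =>
    ne_top_of_le_ne_top hν (le_of_le_of_eq (Finset.single_le_sum
      (f := fun i => ∫⁻ ω, ENNReal.ofReal ((q ω : I → ℝ) i) ∂ν) (fun _ _ => zero_le)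
      (Finset.mem_univ i)) hsum)
  refine ⟨⟨fun i => ((∫⁻ ω, ENNReal.ofReal ((q ω : I → ℝ) i) ∂ν) / ν Set.univ).toReal,
    fun i => ENNReal.toReal_nonneg, ?_⟩, fun i => ?_⟩
  · rw [← ENNReal.toReal_sum fun i _ => ENNReal.div_ne_top (hle i) h0']
    simp_rw [div_eq_mul_inv]
    rw [← Finset.sum_mul, hsum, ENNReal.mul_inv_cancel h0' hν, ENNReal.toReal_one]
  · change ν Set.univ * ENNReal.ofReal (ENNReal.toReal _) = _
    rw [ENNReal.ofReal_toReal (ENNReal.div_ne_top (hle i) h0'), ENNReal.mul_div_cancel h0' hν]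

namespace MDP

variable {S A : Type u} [Fintype S] [Fintype A] [MeasurableSpace S] [MeasurableSpace A]
  [DiscreteMeasurableSpace S] [DiscreteMeasurableSpace A] {H : ℕ}

theorem measurable_visitation (M : MDP S A H) (s₀ : S) (h : Fin H) (s : S) (a : A) :
    Measurable fun π : Policy S A H => M.visitation s₀ π h s a :=
  (Kernel.measurable_coe M.episodeKernel ((measurable_pi_apply h)
    (measurableSet_stateAction s a))).comp (measurable_id.prodMk measurable_const)

theorem measurable_prob (h : Fin H) (s : S) (a : A) :
    Measurable fun π : Policy S A H => ENNReal.ofReal ((π h s : A → ℝ) a) :=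
  ENNReal.measurable_ofReal.comp ((measurable_pi_apply a).comp
    (measurable_subtype_coe.comp ((measurable_pi_apply s).comp (measurable_pi_apply h))))

/-- The visitation probabilities of a mixture of Markovian policies, with a random initial state,
are those of a single Markovian policy. -/
theorem exists_policy_visitation_mixture : ∀ {H : ℕ} (M : MDP S A H) (_ : Policy S A H)
    (ν : S → Measure (Policy S A H)) (_ : ∀ s, ν s Set.univ ≠ ⊤), ∃ ρ : Policy S A H,
      ∀ h s a, ∑ s₀, ν s₀ Set.univ * M.visitation s₀ ρ h s a =
        ∑ s₀, ∫⁻ π, M.visitation s₀ π h s a ∂(ν s₀)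
  | 0, _, π₀, _, _ => ⟨π₀, fun h => h.elim0⟩
  | H + 1, M, π₀, ν, hν => by
    classical
    -- The first stage of `ρ` plays in state `s` the average action law of the policies drawn from
    -- `ν s`.
    have hq : ∀ s, ∃ p : stdSimplex ℝ A, ∀ a, ν s Set.univ * ENNReal.ofReal ((p : A → ℝ) a) =
        ∫⁻ π, ENNReal.ofReal ((π 0 s : A → ℝ) a) ∂(ν s) := fun s =>
      exists_stdSimplex_mean (hν s) ((measurable_pi_apply s).comp (measurable_pi_apply 0))
        (π₀ 0 s)
    choose p hp using hq
    -- The joint weight of reaching `s'` and of the remaining policy. The action and state reached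
    -- are informative about the policy drawn, so the mixture depends on the state; hence the
    -- induction runs over families of finite measures.
    set ν' : S → Measure (Policy S A H) := fun s' => ∑ s, ∑ a,
      ENNReal.ofReal ((M.trans 0 s a : S → ℝ) s') •
        ((ν s).withDensity fun π => ENNReal.ofReal ((π 0 s : A → ℝ) a)).map tailPolicy with hν'
    have hlint : ∀ s' {f : Policy S A H → ℝ≥0∞}, Measurable f → ∫⁻ π, f π ∂(ν' s') =
        ∑ s, ∑ a, ENNReal.ofReal ((M.trans 0 s a : S → ℝ) s') *
          ∫⁻ π, ENNReal.ofReal ((π 0 s : A → ℝ) a) * f (tailPolicy π) ∂(ν s) := by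
      intro s' f hf
      simp only [hν', lintegral_finsetSum_measure, lintegral_smul_measure, smul_eq_mul]
      refine Finset.sum_congr rfl fun s _ => Finset.sum_congr rfl fun a _ => ?_
      rw [lintegral_map hf measurable_tailPolicy]
      exact congrArg _ (lintegral_withDensity_eq_lintegral_mul _
        (measurable_prob 0 s a) (hf.comp measurable_tailPolicy))
    -- The mass reaching `s'` is the same as when `p` is played at the first stage.
    have huniv : ∀ s', ν' s' Set.univ = ∑ s, ∑ a, ENNReal.ofReal ((M.trans 0 s a : S → ℝ) s') *
        (ν s Set.univ * ENNReal.ofReal ((p s : A → ℝ) a)) := by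
      intro s'
      rw [← lintegral_one, hlint s' measurable_const]
      simp_rw [mul_one, hp]
    obtain ⟨ρ, hρ⟩ := exists_policy_visitation_mixture M.tail (tailPolicy π₀) ν' fun s' => by
      rw [huniv, ENNReal.sum_ne_top]
      exact fun s _ => ENNReal.sum_ne_top.2 fun a _ => ENNReal.mul_ne_top ENNReal.ofReal_ne_top
        (ENNReal.mul_ne_top (hν s) ENNReal.ofReal_ne_top)
    refine ⟨Fin.cons p ρ, fun h s a => ?_⟩
    have htail : tailPolicy (Fin.cons p ρ : Policy S A (H + 1)) = ρ := by
      ext h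
      simp [tailPolicy]
    refine Fin.cases ?_ (fun i => ?_) h
    · refine Finset.sum_congr rfl fun s₀ _ => ?_
      simp only [visitation_zero, Fin.cons_zero]
      split_ifs
      · exact hp s₀ a
      · simp
    · simp only [visitation_succ, htail, Fin.cons_zero]
      have hmeas := fun s' => measurable_visitation M.tail s' i s a
      have key := hρ i s a
      simp_rw [hlint _ (hmeas _), huniv, Finset.sum_mul] at key
      refine (Eq.trans ?_ key).trans ?_
      · rw [Finset.sum_comm]
        refine Finset.sum_congr rfl fun s₀ _ => ?_
        rw [Finset.mul_sum, Finset.sum_comm]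
        refine Finset.sum_congr rfl fun b _ => ?_
        rw [Finset.mul_sum, Finset.mul_sum]
        refine Finset.sum_congr rfl fun s' _ => ?_
        ring
      · rw [Finset.sum_comm]
        refine Finset.sum_congr rfl fun s₀ _ => ?_
        symm
        refine (lintegral_finsetSum _ fun b _ => (measurable_prob 0 s₀ b).mul
          (Finset.measurable_sum _ fun s' _ =>
            ((hmeas s').comp measurable_tailPolicy).const_mul _)).trans ?_
        rw [Finset.sum_comm]
        refine Finset.sum_congr rfl fun b _ => ?_
        simp only [Pi.mul_apply, Function.comp_apply, Finset.mul_sum]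
        refine (lintegral_finsetSum _ fun s' _ => (measurable_prob 0 s₀ b).mul
            (((hmeas s').comp measurable_tailPolicy).const_mul _)).trans ?_
        refine Finset.sum_congr rfl fun s' _ => ?_
        refine Eq.trans ?_ (lintegral_const_mul _ ((measurable_prob 0 s₀ b).mul
          ((hmeas s').comp measurable_tailPolicy)))
        refine lintegral_congr fun π => ?_
        simp only [Function.comp, Pi.mul_apply]
        ring

/-- The set is empty or a superlevel set of the measurable value function, so existence of a
maximizer is not needed. -/
theorem measurableSet_optimalPolicies (M : MDP S A H) (s₀ : S) :
    MeasurableSet (M.optimalPolicies s₀) := by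
  have hval : Measurable (M.value s₀) := by
    have h1 : StronglyMeasurable fun z : Policy S A H × S =>
        ∫ ω, ∑ h, (ω h).2.2.1 ∂(M.episodeKernel z) :=
      StronglyMeasurable.integral_kernel (by
        refine (Finset.measurable_sum _ fun h _ => ?_).stronglyMeasurable
        fun_prop)
    exact h1.measurable.comp (measurable_id.prodMk measurable_const)
  by_cases hne : (M.optimalPolicies s₀).Nonempty
  · obtain ⟨π₀, h₀⟩ := hne
    have : M.optimalPolicies s₀ = M.value s₀ ⁻¹' Set.Ici (M.value s₀ π₀) := by
      ext π
      exact ⟨fun h => h π₀, fun h π' => (h₀ π').trans h⟩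
    rw [this]
    exact hval measurableSet_Ici
  · rw [Set.not_nonempty_iff_eq_empty.1 hne]
    exact MeasurableSet.empty

end MDP

/-! ### Occupation measure and change of measure for an algorithm -/

namespace Algorithm

open Preorder

variable {U S A : Type u} [Fintype S] [Fintype A] [MeasurableSpace U] [MeasurableSpace S]
  [MeasurableSpace A] [DiscreteMeasurableSpace S] [DiscreteMeasurableSpace A] {H : ℕ}

/-- The law of the seed, as a law of the observation revealed at time `0`. -/
def initialLaw (alg : Algorithm U S A H) : Measure (Obs U S A H 0) := alg.seedLaw

instance (alg : Algorithm U S A H) : IsProbabilityMeasure alg.initialLaw := alg.seedLaw_prob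

theorem measurableSet_lt_τ (alg : Algorithm U S A H) (t : ℕ) :
    MeasurableSet {ω | (t : WithTop ℕ) < alg.τ ω} :=
  Filtration.le _ t _ (alg.isStoppingTime_τ.measurableSet_gt t)

theorem toENNReal_τ (alg : Algorithm U S A H) (ω : (t : ℕ) → Obs U S A H t) :
    ENat.toENNReal (alg.τ ω) =
      ∑' t : ℕ, {ω | (t : WithTop ℕ) < alg.τ ω}.indicator (fun _ => (1 : ℝ≥0∞)) ω :=
  toENNReal_eq_tsum (alg.τ ω)

theorem measurable_toENNReal_τ (alg : Algorithm U S A H) :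
    Measurable fun ω => ENat.toENNReal (alg.τ ω) := by
  simp_rw [toENNReal_τ]
  exact Measurable.tsum fun t => measurable_const.indicator (alg.measurableSet_lt_τ t)

theorem expectedTime_eq_tsum (alg : Algorithm U S A H) (M : MDP S A H) (sInit : S) :
    alg.expectedTime M sInit = ∑' t : ℕ, alg.law M sInit {ω | (t : WithTop ℕ) < alg.τ ω} := by
  unfold expectedTime
  simp_rw [toENNReal_τ]
  rw [lintegral_tsum fun t =>
    (measurable_const.indicator (alg.measurableSet_lt_τ t)).aemeasurable]
  refine tsum_congr fun t => ?_
  exact lintegral_indicator_one (alg.measurableSet_lt_τ t)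

/-- The expected visitation counts up to the stopping time are those of a single Markovian policy,
played for the expected number of episodes. -/
theorem exists_policy_tsum_visitation (alg : Algorithm U S A H) (M : MDP S A H) (sInit : S)
    (hτ : alg.expectedTime M sInit ≠ ⊤) :
    ∃ ρ : Policy S A H, ∀ h s a,
      ∑' t : ℕ, ∫⁻ ω, {ω | (t : WithTop ℕ) < alg.τ ω}.indicator (fun ω =>
        M.visitation sInit (alg.explore t (frestrictLe t ω)) h s a) ω ∂(alg.law M sInit) =
      alg.expectedTime M sInit * M.visitation sInit ρ h s a := by
  classical
  have hex : ∀ t, Measurable fun ω : (t : ℕ) → Obs U S A H t =>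
      alg.explore t (frestrictLe t ω) := fun t =>
    (alg.measurable_explore t).comp (by fun_prop)
  -- The occupation measure: the expected number of episodes before `τ` whose policy lies in a given
  -- set. Its total mass is the expected time.
  set ν : Measure (Policy S A H) := Measure.sum fun t : ℕ =>
    ((alg.law M sInit).restrict {ω | (t : WithTop ℕ) < alg.τ ω}).map
      (fun ω => alg.explore t (frestrictLe t ω)) with hνdef
  have hlint : ∀ {f : Policy S A H → ℝ≥0∞}, Measurable f → ∫⁻ π, f π ∂ν =
      ∑' t : ℕ, ∫⁻ ω, {ω | (t : WithTop ℕ) < alg.τ ω}.indicator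
        (fun ω => f (alg.explore t (frestrictLe t ω))) ω ∂(alg.law M sInit) := by
    intro f hf
    rw [hνdef, lintegral_sum_measure]
    refine tsum_congr fun t => ?_
    rw [lintegral_map hf (hex t), lintegral_indicator (alg.measurableSet_lt_τ t)]
  have huniv : ν Set.univ = alg.expectedTime M sInit := by
    rw [← lintegral_one, hlint measurable_const, expectedTime_eq_tsum]
    exact tsum_congr fun t => lintegral_indicator_one (alg.measurableSet_lt_τ t)
  have hU : Nonempty U :=
    @nonempty_of_isProbabilityMeasure _ _ alg.seedLaw alg.seedLaw_prob
  obtain ⟨u⟩ := hU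
  -- Some policy must exist; the one explored on an arbitrary seed is used.
  have π₀ : Policy S A H := alg.explore 0 fun ⟨i, hi⟩ => by
    obtain rfl : i = 0 := Nat.le_zero.1 (Finset.mem_Iic.1 hi)
    exact u
  -- All the mass starts in `sInit`.
  obtain ⟨ρ, hρ⟩ := M.exists_policy_visitation_mixture π₀
    (fun s => if s = sInit then ν else 0) fun s => by
      split_ifs
      · rwa [huniv]
      · simp
  refine ⟨ρ, fun h s a => ?_⟩
  rw [← hlint (M.measurable_visitation sInit h s a), ← huniv]
  have := hρ h s a
  rw [Finset.sum_eq_single sInit, Finset.sum_eq_single sInit] at this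
  · simpa using this.symm
  · intro b _ hb
    simp [hb]
  · simp
  · intro b _ hb
    simp [hb]
  · simp

/-- The change of measure between a model and an alternative one, at the stopping time. -/
theorem binary_relative_entropy_le_tsum_visitation (alg : Algorithm U S A H)
    {M M' : MDP S A H} {sInit : S} {δ : ℝ} (hδ : 0 < δ) (hδ' : δ ≤ 1 / 2)
    (halg : alg.IsPAC sInit δ) (hM' : M' ∈ M.alt sInit)
    (hτ : alg.expectedTime M sInit ≠ ⊤) :
    ENNReal.ofReal ((1 - 2 * δ) * Real.log ((1 - δ) / δ)) ≤
      ∑' t : ℕ, ∫⁻ ω, {ω | (t : WithTop ℕ) < alg.τ ω}.indicator (fun ω => ∑ h, ∑ s, ∑ a,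
        M.visitation sInit (alg.explore t (frestrictLe t ω)) h s a * M.kl M' h s a) ω
        ∂(alg.law M sInit) := by
  obtain ⟨hac, hopt⟩ := hM'
  obtain ⟨C, hC, hlC⟩ := MDP.lintegral_enorm_episodeLLR_le hac sInit
  have hR : ∀ t, MeasurableSet {x : History U S A H t |
      alg.recommend t x ∈ M.optimalPolicies sInit} := fun t =>
    alg.measurable_recommend t (M.measurableSet_optimalPolicies sInit)
  -- Finite expected time makes `τ = ⊤` negligible, so under `M` the complement of the event is, up
  -- to a null set, the PAC error.
  have htop : alg.law M sInit {ω | alg.τ ω = ⊤} = 0 := by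
    have h := measure_eq_top_of_lintegral_ne_top
      alg.measurable_toENNReal_τ.aemeasurable hτ
    refine measure_mono_null (fun ω hω => ?_) h
    exact (congrArg ENat.toENNReal hω).trans ENat.toENNReal_top
  refine AdaptiveProcess.binary_relative_entropy_le_tsum (X := Obs U S A H)
    (μ₀ := alg.initialLaw) (κ := alg.nextEpisode M sInit) (κ' := alg.nextEpisode M' sInit)
    (l := fun _ => M.episodeLLR M')
    (R := fun t => {x | alg.recommend t x ∈ M.optimalPolicies sInit})
    (k := fun t x => ∑ h, ∑ s, ∑ a, M.visitation sInit (alg.explore t x) h s a * M.kl M' h s a)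
    alg.isStoppingTime_τ hR (fun _ => MDP.measurable_episodeLLR M M')
    (fun t x g hg => MDP.lintegral_mul_exp_neg_episodeLLR_le hac _ _ hg) hC
    (fun t x => hlC _) (fun t x => (MDP.integral_episodeLLR hac sInit _).le) hδ hδ' ?_ ?_
  · refine (measure_mono (fun ω hω => ?_)).trans ((measure_union_le {ω | alg.τ ω = ⊤} _).trans
      (le_of_eq_of_le ((congrArg (· + _) htop).trans (zero_add _)) (halg M)))
    by_cases h : alg.τ ω = ⊤
    · exact Or.inl h
    · obtain ⟨t, ht⟩ := WithTop.ne_top_iff_exists.1 h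
      exact Or.inr ⟨t, ht.symm, fun h' => hω ⟨t, ht.symm, h'⟩⟩
  -- A policy optimal in `M` is not optimal in `M'`, so here the event itself is a PAC error.
  · refine (measure_mono ?_).trans (halg M')
    rintro ω ⟨t, ht, h⟩
    refine ⟨t, ht, fun h' => ?_⟩
    have : alg.recommend t (frestrictLe t ω) ∈
      M.optimalPolicies sInit ∩ M'.optimalPolicies sInit := ⟨h, h'⟩
    rw [hopt] at this
    exact this

end Algorithm

end

/-! ### The lower bound -/

theorem theorem1 {U S A : Type u} [Fintype S] [Fintype A] [MeasurableSpace U]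
    [MeasurableSpace S] [MeasurableSpace A] [DiscreteMeasurableSpace S]
    [DiscreteMeasurableSpace A] {H : ℕ} (sInit : S) (δ : ℝ) (hδ : 0 < δ) (hδ' : δ < 1)
    (alg : Algorithm U S A H) (halg : alg.IsPAC sInit δ) (M : MDP S A H) :
    (M.Gam sInit)⁻¹ * ENNReal.ofReal (Real.log (1 / (2.4 * δ))) ≤
      alg.expectedTime M sInit := by
  rcases le_or_gt (Real.log (1 / (2.4 * δ))) 0 with hlog | hlog
  · rw [ENNReal.ofReal_eq_zero.2 hlog, mul_zero]
    exact zero_le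
  by_cases hτ : alg.expectedTime M sInit = ⊤
  · rw [hτ]
    exact le_top
  by_cases hΓ : M.Gam sInit = ⊤
  · simp [hΓ]
  -- A positive logarithm means `δ < 1/2.4`.
  have hδ2 : δ < 1 / 2 := by
    by_contra! h
    refine hlog.not_ge (Real.log_nonpos (by positivity) ?_)
    rw [div_le_one (by positivity)]
    linarith
  -- `ρ` is chosen before the alternative, so one visitation vector serves all of `M.alt sInit`.
  obtain ⟨ρ, hρ⟩ := alg.exists_policy_tsum_visitation M sInit hτ
  have hmain : ∀ M' ∈ M.alt sInit, ENNReal.ofReal (Real.log (1 / (2.4 * δ))) ≤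
      alg.expectedTime M sInit * ∑ h, ∑ s, ∑ a, M.visitation sInit ρ h s a * M.kl M' h s a := by
    intro M' hM'
    refine (ENNReal.ofReal_le_ofReal (log_inv_le_binary_relative_entropy hδ hδ2)).trans ?_
    refine (alg.binary_relative_entropy_le_tsum_visitation hδ hδ2.le halg hM' hτ).trans
      (le_of_eq ?_)
    have hvm : ∀ (t : ℕ) h s a, Measurable fun ω : (t : ℕ) → Obs U S A H t =>
        {ω | (t : WithTop ℕ) < alg.τ ω}.indicator (fun ω =>
          M.visitation sInit (alg.explore t (Preorder.frestrictLe t ω)) h s a) ω := fun t h s a =>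
      ((M.measurable_visitation sInit h s a).comp
        ((alg.measurable_explore t).comp (by fun_prop))).indicator (alg.measurableSet_lt_τ t)
    -- The divergences are constants, so by linearity only the expected visits remain to be summed
    -- over `t`, and `hρ` evaluates that sum.
    have hsplit : ∀ (t : ℕ), ∫⁻ ω, {ω | (t : WithTop ℕ) < alg.τ ω}.indicator (fun ω =>
          ∑ h, ∑ s, ∑ a, M.visitation sInit (alg.explore t (Preorder.frestrictLe t ω)) h s a *
            M.kl M' h s a) ω ∂(alg.law M sInit) =
        ∑ h, ∑ s, ∑ a, (∫⁻ ω, {ω | (t : WithTop ℕ) < alg.τ ω}.indicator (fun ω =>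
          M.visitation sInit (alg.explore t (Preorder.frestrictLe t ω)) h s a) ω
            ∂(alg.law M sInit)) * M.kl M' h s a := by
      intro t
      have hpt : ∀ ω : (t : ℕ) → Obs U S A H t, {ω | (t : WithTop ℕ) < alg.τ ω}.indicator
          (fun ω => ∑ h, ∑ s, ∑ a, M.visitation sInit
            (alg.explore t (Preorder.frestrictLe t ω)) h s a * M.kl M' h s a) ω =
          ∑ h, ∑ s, ∑ a, {ω | (t : WithTop ℕ) < alg.τ ω}.indicator (fun ω => M.visitation sInit
            (alg.explore t (Preorder.frestrictLe t ω)) h s a) ω * M.kl M' h s a := by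
        intro ω
        by_cases h : ω ∈ {ω | (t : WithTop ℕ) < alg.τ ω}
        · simp only [Set.indicator_of_mem h]
        · simp only [Set.indicator_of_notMem h, zero_mul, Finset.sum_const_zero]
      simp_rw [hpt]
      rw [lintegral_finsetSum _ fun h _ => Finset.measurable_sum _ fun s _ =>
        Finset.measurable_sum _ fun a _ => (hvm t h s a).mul_const _]
      refine Finset.sum_congr rfl fun h _ => ?_
      rw [lintegral_finsetSum _ fun s _ => Finset.measurable_sum _ fun a _ =>
        (hvm t h s a).mul_const _]
      refine Finset.sum_congr rfl fun s _ => ?_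
      rw [lintegral_finsetSum _ fun a _ => (hvm t h s a).mul_const _]
      refine Finset.sum_congr rfl fun a _ => ?_
      rw [lintegral_mul_const _ (hvm t h s a)]
    simp_rw [hsplit]
    rw [Summable.tsum_finsetSum fun _ _ => ENNReal.summable, Finset.mul_sum]
    refine Finset.sum_congr rfl fun h _ => ?_
    rw [Summable.tsum_finsetSum fun _ _ => ENNReal.summable, Finset.mul_sum]
    refine Finset.sum_congr rfl fun s _ => ?_
    rw [Summable.tsum_finsetSum fun _ _ => ENNReal.summable, Finset.mul_sum]
    refine Finset.sum_congr rfl fun a _ => ?_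
    rw [ENNReal.tsum_mul_right, hρ, mul_assoc]
  have hdiv : ENNReal.ofReal (Real.log (1 / (2.4 * δ))) / alg.expectedTime M sInit ≤
      M.Gam sInit := by
    refine le_trans (le_iInf₂ fun M' hM' => ENNReal.div_le_of_le_mul' (hmain M' hM')) ?_
    exact le_iSup₂ (f := fun w (_ : w ∈ M.visitationSet sInit) =>
      ⨅ M' ∈ M.alt sInit, ∑ h, ∑ s, ∑ a, w h s a * M.kl M' h s a) _ ⟨ρ, rfl⟩
  rw [mul_comm, ← div_eq_mul_inv]
  refine ENNReal.div_le_of_le_mul' ?_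
  -- Finiteness of `Γ_M` covers the case of zero expected time.
  exact (ENNReal.div_le_iff_le_mul (Or.inr hΓ) (Or.inl hτ)).1 hdiv
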